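/- All groups are finite. Let $p$ be a prime. A chief factor of a group $X$ is a quotient $L/K$ with $K<L$ normal subgroups of $X$ and no normal subgroup of $X$ strictly between them. A group is $p$-nilpotent if it has a normal subgroup of order prime to $p$ whose quotient is a $p$-group, and $p$-supersoluble if each of its chief factors has order $p$ or order prime to $p$; let $\mathfrak{U}_p$ be the class of $p$-supersoluble groups. A chief factor $L/K$ of $X$ is $\mathfrak{U}_p$-central if $(L/K)\rtimes (X/C_X(L/K))\in\mathfrak{U}_p$ (conjugation action), and the $\mathfrak{U}_p$-hypercentre $Z_{\mathfrak{U}_p}(X)$ is the product of all normal subgroups $N$ of $X$ such that every chief factor $L/K$ of $X$ with $L\le N$ is $\mathfrak{U}_p$-central. A subgroup of $X$ is $S$-quasinormal in $X$ if it permutes with every Sylow subgroup of $X$. For $H\le G$ let $H_G$ be the largest normal subgroup of $G$ contained in $H$. The subgroup $H$ is weakly $(\mathfrak{U}_p)_s$-quasinormal in $G$ if there is an $S$-quasinormal subgroup $T$ of $G$ such that $HT$ is an $S$-quasinormal subgroup of $G$ and $(H\cap T)H_G/H_G\le Z_{\mathfrak{U}_p}(G/H_G)$. The subgroup $H$ has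 a $p$-nilpotent supplement in $G$ if $G=HK$ for some $p$-nilpotent subgroup $K$ of $G$. **Theorem.** Let $G$ be a group and $p$ a prime divisor of $|G|$ with $(|G|,p-1)=1$. Let $E$ be a normal subgroup of $G$ such that $G/E$ is $p$-nilpotent. Suppose that $E$ has a Sylow $p$-subgroup $P$ such that every cyclic subgroup $H$ of $P$ which has order $p$, or which has order $4$ in the case that $P$ is a non-abelian $2$-group, either is weakly $(\mathfrak{U}_p)_s$-quasinormal in $G$ or has a $p$-nilpotent supplement in $G$. Then $G$ is $p$-nilpotent. -/

import Mathlib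

universe u

namespace WeakQN

open scoped Pointwise

/-- `L / K` is a chief factor of `G`: `K < L` are normal subgroups of `G` and no normal subgroup
of `G` lies strictly between them. -/
def IsChiefFactor {G : Type u} [Group G] (L K : Subgroup G) : Prop :=
  L.Normal ∧ K.Normal ∧ K < L ∧
    ∀ N : Subgroup G, N.Normal → K ≤ N → N ≤ L → N = K ∨ N = L

/-- A finite group is `p`-nilpotent if it has a normal `p`-complement: a normal subgroup of order
prime to `p` whose quotient is a `p`-group. -/
def IsPNilpotent (p : ℕ) (G : Type u) [Group G] : Prop :=
  ∃ N : Subgroup G, ∃ _ : N.Normal, ¬ p ∣ Nat.card N ∧ IsPGroup p (G ⧸ N)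

/-- A finite group is `p`-supersoluble if each of its chief factors either has order `p` or is a
`p'`-group. Here `K.relIndex L` is the order of `L / K`. -/
def IsPSupersoluble (p : ℕ) (G : Type u) [Group G] : Prop :=
  ∀ L K : Subgroup G, IsChiefFactor L K → K.relIndex L = p ∨ ¬ p ∣ K.relIndex L

/-- The quotient `L / K`, for normal subgroups `K ≤ L` of `G`, as a subgroup of `G / K`. -/
def factor {G : Type u} [Group G] (L K : Subgroup G) [K.Normal] : Subgroup (G ⧸ K) :=
  L.map (QuotientGroup.mk' K)

instance factor_normal {G : Type u} [Group G] (L K : Subgroup G) [hL : L.Normal] [K.Normal] :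
    (factor L K).Normal :=
  hL.map _ (QuotientGroup.mk'_surjective K)

/-- The action of `G` on `L / K` by conjugation. Its kernel is `C_G(L / K)`. -/
def conjAction {G : Type u} [Group G] (L K : Subgroup G) [L.Normal] [K.Normal] :
    G →* MulAut (factor L K) :=
  (MulAut.conjNormal (H := factor L K)).comp (QuotientGroup.mk' K)

/-- The semidirect product `(L / K) ⋊ (G / C_G(L / K))` for the conjugation action. -/
abbrev FactorSemidirect {G : Type u} [Group G] (L K : Subgroup G) [L.Normal] [K.Normal] : Type u :=
  factor L K ⋊[QuotientGroup.kerLift (conjAction L K)] (G ⧸ (conjAction L K).ker)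

/-- `L / K` is `𝔉`-central in `G`: `(L / K) ⋊ (G / C_G(L / K))` belongs to the class `𝔉`. -/
def IsFCentral (F : ∀ (X : Type u) [Group X], Prop) {G : Type u} [Group G]
    (L K : Subgroup G) [L.Normal] [K.Normal] : Prop :=
  F (FactorSemidirect L K)

/-- A normal subgroup `N` of `G` is `𝔉`-hypercentral in `G` if every chief factor of `G` below `N`
is `𝔉`-central (for `N = 1` there is none). -/
def IsFHypercentral (F : ∀ (X : Type u) [Group X], Prop) {G : Type u} [Group G]
    (N : Subgroup G) : Prop :=
  N.Normal ∧ ∀ (L K : Subgroup G) [L.Normal] [K.Normal],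
    IsChiefFactor L K → L ≤ N → IsFCentral F L K

/-- The `𝔉`-hypercentre `Z_𝔉(G)`: the product (that is, the join) of all `𝔉`-hypercentral normal
subgroups of `G`. -/
def FHypercentre (F : ∀ (X : Type u) [Group X], Prop) (G : Type u) [Group G] : Subgroup G :=
  sSup {N : Subgroup G | IsFHypercentral F N}

/-- `H` is `S`-quasinormal in `G`: it permutes with every Sylow subgroup of `G`. -/
def IsSQuasinormal {G : Type u} [Group G] (H : Subgroup G) : Prop :=
  ∀ q : ℕ, q.Prime → ∀ Q : Sylow q G,
    (H : Set G) * (Q : Set G) = (Q : Set G) * (H : Set G)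

/-- `H` is weakly `𝔉_s`-quasinormal in `G`: there is an `S`-quasinormal subgroup `T` of `G` such
that the set `HT` is an `S`-quasinormal subgroup `R` of `G` and
`(H ∩ T) H_G / H_G ≤ Z_𝔉(G / H_G)`, with `H_G` the largest normal subgroup of `G` inside `H`. -/
def IsWeaklyFsQuasinormal (F : ∀ (X : Type u) [Group X], Prop) {G : Type u} [Group G]
    (H : Subgroup G) : Prop :=
  ∃ T : Subgroup G, IsSQuasinormal T ∧
    (∃ R : Subgroup G, (R : Set G) = (H : Set G) * (T : Set G) ∧ IsSQuasinormal R) ∧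
    ((H ⊓ T) ⊔ H.normalCore).map (QuotientGroup.mk' H.normalCore) ≤
      FHypercentre F (G ⧸ H.normalCore)

/-- `H` has a `p`-nilpotent supplement in `G`: `G = HK` for a `p`-nilpotent subgroup `K`. -/
def HasPNilpotentSupplement (p : ℕ) {G : Type u} [Group G] (H : Subgroup G) : Prop :=
  ∃ K : Subgroup G, (H : Set G) * (K : Set G) = Set.univ ∧ IsPNilpotent p K

end WeakQN

/-!
All proper subgroups inherit the hypothesis, so the heart of the matter is a minimal
counterexample: a group `G` that is not `p`-nilpotent although its proper subgroups are, and whose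
elements of order `p` (and `4`) generate subgroups `H` that are weakly quasinormal or
supplemented.

*Inheritance.* Weak `(𝔘_p)_s`-quasinormality of `H` refers to a hypercentre, which is awkward to
restrict to subgroups. Since `(|G|, p - 1) = 1`, chief factors of order `p` are central, so the
hypercentre has a series of normal subgroups with central or `p'`-factors (`HasCentralSeries`). A
`p'`-element that normalises a `p`-subgroup `D` therefore centralises the part of `D` in the
hypercentre (`HasCentralSeries.commute`). The condition `IsCentrallyEmbedded` keeps only this
consequence. It passes to subgroups because `S`-quasinormality does (`IsSQuasinormal.subgroupOf`):
for `T` `S`-quasinormal and `Q` a Sylow `q`-subgroup, all `r`-subgroups of `TQ` with `r ≠ q` lie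
in `T`. The normal subgroup `E` is exchanged for the preimage of the `p`-complement of `G / E`; it
has the same `p`-subgroups and `p`-power index in `G`, so it suffices that it is `p`-nilpotent,
and for it the hypothesis concerns all its elements.

*The minimal counterexample.* By minimality `G` has no proper normal subgroup of `p`-power index.
If `G` centralised all its normal `p`-subgroups, then normalisers of non-central `p`-subgroups
would be proper, hence `p`-nilpotent; a Sylow `p`-subgroup `P` would control its own fusion, and
transfer into `P / P'` would give `P = 1` (`exists_normal_not_commute`). So some `p'`-element `g`
acts nontrivially on a normal `p`-subgroup `D`. Then `g` centralises each normal subgroup of `G`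
properly inside `D` (`commute_of_ne`) and acts nontrivially on each nontrivial quotient of `D`
(`eq_of_forall_commutator_mem`). On a cyclic group of order `p` or `4` it can only induce the
trivial automorphism, so `D` has no proper normal subgroup of `G` with cyclic quotient of that
order. This rules out `p`-nilpotent supplements (`not_hasPNilpotentSupplement`), and it forces `g`
to centralise every centrally embedded `H ≤ D` (`IsCentrallyEmbedded.commute`). Hence `g`
centralises all elements of `D` of order `p` (and `4`), and a commutator calculation in `D` shows
that it centralises `D` (`false_of_forall_commute`), a contradiction.
-/

namespace WeakQN

open scoped Pointwise

variable {G : Type u} [Group G]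

/-! ### `p`-nilpotency through `p'`-elements -/

lemma orderOf_conj_eq (g x : G) : orderOf (g * x * g⁻¹) = orderOf x :=
  orderOf_injective (MulAut.conj g).toMonoidHom (MulAut.conj g).injective x

lemma zpowers_coe_subgroupOf {M : Subgroup G} (x : M) :
    (Subgroup.zpowers (x : G)).subgroupOf M = Subgroup.zpowers x := by
  refine Subgroup.map_injective M.subtype_injective ?_
  rw [Subgroup.map_subgroupOf_eq_of_le (Subgroup.zpowers_le.2 x.2), MonoidHom.map_zpowers]
  rfl

/-- Some power `x ^ p ^ k` of an element of a finite group is a `p'`-element. -/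
lemma exists_pow_coprime [Finite G] {p : ℕ} (hp : p.Prime) (x : G) :
    ∃ k : ℕ, p.Coprime (orderOf (x ^ p ^ k)) := by
  obtain ⟨k, m, hm, h⟩ := Nat.exists_eq_pow_mul_and_not_dvd (orderOf_pos x).ne' p hp.ne_one
  refine ⟨k, ?_⟩
  rw [orderOf_pow, h, Nat.gcd_mul_right_left, Nat.mul_div_cancel_left _ (pow_pos hp.pos k)]
  exact (Nat.Prime.coprime_iff_not_dvd hp).2 hm

lemma eq_one_of_coprime_of_isPGroup {p : ℕ} {D : Subgroup G} (hD : IsPGroup p D) {x : G}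
    (hx : x ∈ D) (hc : p.Coprime (orderOf x)) : x = 1 := by
  obtain ⟨k, hk⟩ := hD ⟨x, hx⟩
  have h1 : x ^ p ^ k = 1 := by simpa [Subtype.ext_iff] using hk
  have h2 : (orderOf x).Coprime (p ^ k) := (hc.pow_left k).symm
  exact orderOf_eq_one_iff.1 (Nat.eq_one_of_dvd_coprimes h2 dvd_rfl (orderOf_dvd_of_pow_eq_one h1))

lemma mem_of_coprime_of_isPGroup_quotient {p : ℕ} {N : Subgroup G} [N.Normal]
    (hN : IsPGroup p (G ⧸ N)) {x : G} (hc : p.Coprime (orderOf x)) : x ∈ N := by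
  obtain ⟨k, hk⟩ := hN (x : G ⧸ N)
  rw [← QuotientGroup.eq_one_iff, ← orderOf_eq_one_iff]
  have h2 : (orderOf x).Coprime (p ^ k) := (hc.pow_left k).symm
  exact Nat.eq_one_of_dvd_coprimes h2 (orderOf_map_dvd (QuotientGroup.mk' N) x)
    (orderOf_dvd_of_pow_eq_one hk)

lemma isPGroup_quotient_of_forall_mem [Finite G] {p : ℕ} (hp : p.Prime) {N : Subgroup G} [N.Normal]
    (hN : ∀ x : G, p.Coprime (orderOf x) → x ∈ N) : IsPGroup p (G ⧸ N) := by
  intro x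
  induction x using QuotientGroup.induction_on with
  | H x =>
    obtain ⟨k, hk⟩ := exists_pow_coprime hp x
    refine ⟨k, ?_⟩
    rw [← QuotientGroup.mk_pow, QuotientGroup.eq_one_iff]
    exact hN _ hk

/-- A finite group is `p`-nilpotent exactly when its `p'`-elements are closed under
multiplication; they then form the normal `p`-complement. -/
lemma isPNilpotent_iff [Finite G] {p : ℕ} (hp : p.Prime) :
    IsPNilpotent p G ↔ ∀ x y : G, p.Coprime (orderOf x) → p.Coprime (orderOf y) →
      p.Coprime (orderOf (x * y)) := by
  constructor
  · rintro ⟨N, hN, hcard, hq⟩ x y hx hy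
    have h := N.mul_mem (mem_of_coprime_of_isPGroup_quotient hq hx)
      (mem_of_coprime_of_isPGroup_quotient hq hy)
    exact ((Nat.Prime.coprime_iff_not_dvd hp).2 hcard).coprime_dvd_right
      (Subgroup.orderOf_dvd_natCard N h)
  · intro h
    let N : Subgroup G :=
      { carrier := {x | p.Coprime (orderOf x)}
        mul_mem' := fun {x y} hx hy => h x y hx hy
        one_mem' := by simp
        inv_mem' := fun {x} hx => by simpa using hx }
    have hN : N.Normal := ⟨fun x hx g => by
      change p.Coprime _
      rw [orderOf_conj_eq]; exact hx⟩
    refine ⟨N, hN, fun hd => ?_, isPGroup_quotient_of_forall_mem hp fun x hx => hx⟩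
    have := Fact.mk hp
    obtain ⟨x, hx⟩ := exists_prime_orderOf_dvd_card' p hd
    have h1 : p.Coprime (orderOf (x : G)) := x.2
    rw [Subgroup.orderOf_coe, hx, Nat.coprime_self] at h1
    exact hp.ne_one h1

lemma IsPNilpotent.subgroup [Finite G] {p : ℕ} (hp : p.Prime) (h : IsPNilpotent p G)
    (M : Subgroup G) : IsPNilpotent p M := by
  rw [isPNilpotent_iff hp] at h ⊢
  intro x y hx hy
  rw [← Subgroup.orderOf_coe] at hx hy ⊢
  exact h x y hx hy

lemma isPNilpotent_of_isPGroup_quotient [Finite G] {p : ℕ} (hp : p.Prime) {N : Subgroup G}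
    [N.Normal] (hN : IsPNilpotent p N) (hq : IsPGroup p (G ⧸ N)) : IsPNilpotent p G := by
  rw [isPNilpotent_iff hp] at hN ⊢
  intro x y hx hy
  have := hN ⟨x, mem_of_coprime_of_isPGroup_quotient hq hx⟩
    ⟨y, mem_of_coprime_of_isPGroup_quotient hq hy⟩ (by simpa using hx) (by simpa using hy)
  simpa using this

lemma isPNilpotent_top_iff [Finite G] {p : ℕ} (hp : p.Prime) :
    IsPNilpotent p (⊤ : Subgroup G) ↔ IsPNilpotent p G := by
  refine ⟨fun h => isPNilpotent_of_isPGroup_quotient hp h ?_, fun h => h.subgroup hp _⟩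
  exact isPGroup_quotient_of_forall_mem hp fun x _ => Subgroup.mem_top x

/-- In a `p`-nilpotent subgroup, `p'`-elements centralise normal `p`-subgroups: the commutator
lies both in the normal `p`-complement and in the `p`-subgroup. -/
lemma IsPNilpotent.commute [Finite G] {p : ℕ} (hp : p.Prime) {M D : Subgroup G}
    (hM : IsPNilpotent p M) (hD : IsPGroup p D) (hDM : D ≤ M) {g d : G} (hgM : g ∈ M)
    (hgD : g ∈ Subgroup.normalizer (D : Set G)) (hg : p.Coprime (orderOf g)) (hd : d ∈ D) :
    Commute g d := by
  rw [isPNilpotent_iff hp] at hM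
  have h1 : d * g⁻¹ * d⁻¹ ∈ M := M.mul_mem (M.mul_mem (hDM hd) (M.inv_mem hgM)) (M.inv_mem (hDM hd))
  have h2 : orderOf (d * g⁻¹ * d⁻¹) = orderOf g := by rw [orderOf_conj_eq, orderOf_inv]
  have h3 := hM ⟨g, hgM⟩ ⟨_, h1⟩ (by simpa using hg) (by rw [Subgroup.orderOf_mk, h2]; exact hg)
  rw [← Subgroup.orderOf_coe] at h3
  have h4 : g * (d * g⁻¹ * d⁻¹) ∈ D := by
    have := D.mul_mem ((Subgroup.mem_normalizer_iff.1 hgD d).1 hd) (D.inv_mem hd)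
    simpa [mul_assoc] using this
  have h5 := eq_one_of_coprime_of_isPGroup hD h4 h3
  have h6 : g * d * (d * g)⁻¹ = 1 := by rw [← h5]; group
  exact mul_inv_eq_one.1 h6

/-- The elementary case of coprime action: if a `p'`-element `g` moves `d` by an element `k` of
`p`-power order that commutes with `g`, then `g ^ n` moves `d` by `k ^ n`, so `k = 1`. -/
lemma commute_of_commutator_commute {p : ℕ} {D : Subgroup G} (hD : IsPGroup p D) {g d k : G}
    (hg : p.Coprime (orderOf g)) (hk : k ∈ D) (hgk : Commute g k) (h : g * d * g⁻¹ = d * k) :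
    Commute g d := by
  have h1 : ∀ n : ℕ, g ^ n * d * (g ^ n)⁻¹ = d * k ^ n := by
    intro n
    induction n with
    | zero => simp
    | succ n ih =>
      calc g ^ (n + 1) * d * (g ^ (n + 1))⁻¹ = g * (g ^ n * d * (g ^ n)⁻¹) * g⁻¹ := by
            rw [pow_succ']; group
        _ = (g * d * g⁻¹) * (g * k ^ n * g⁻¹) := by rw [ih]; group
        _ = d * k ^ (n + 1) := by
            rw [h, (hgk.pow_right n).eq, mul_inv_cancel_right, pow_succ', mul_assoc]
  have h2 := h1 (orderOf g)
  rw [pow_orderOf_eq_one] at h2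
  have h3 : k ^ orderOf g = 1 := by simpa using h2
  have h4 : k = 1 := eq_one_of_coprime_of_isPGroup hD hk
    (hg.coprime_dvd_right (orderOf_dvd_of_pow_eq_one h3))
  rw [h4, mul_one] at h
  exact mul_inv_eq_iff_eq_mul.1 h

/-- A subgroup that contains all elements of `q`-power order for the primes `q ≠ p` contains all
`p'`-elements. -/
lemma mem_of_coprime_of_forall_prime_ne [Finite G] {p : ℕ} (hp : p.Prime) {N : Subgroup G}
    (hN : ∀ q : ℕ, q.Prime → q ≠ p → ∀ Q : Sylow q G, (Q : Subgroup G) ≤ N) {x : G}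
    (hx : p.Coprime (orderOf x)) : x ∈ N := by
  rw [← Subgroup.zpowers_le, ← Subgroup.relIndex_eq_one]
  by_contra hne
  obtain ⟨q, hq, hqd⟩ := Nat.exists_prime_and_dvd hne
  have := Fact.mk hq
  have hqp : q ≠ p := by
    rintro rfl
    have : q ∣ orderOf x := by
      rw [← Nat.card_zpowers]; exact hqd.trans (Subgroup.relIndex_dvd_card _ _)
    exact hq.ne_one (Nat.eq_one_of_dvd_coprimes hx dvd_rfl this)
  let S : Sylow q (Subgroup.zpowers x) := default
  obtain ⟨Q, hQ⟩ := (S.isPGroup'.map (Subgroup.zpowers x).subtype).exists_le_sylow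
  have h1 : (S : Subgroup (Subgroup.zpowers x)) ≤ N.subgroupOf (Subgroup.zpowers x) := by
    rw [Subgroup.subgroupOf, ← Subgroup.map_le_iff_le_comap]
    exact hQ.trans (hN q hq hqp Q)
  have h2 := Subgroup.index_dvd_of_le h1
  exact S.not_dvd_index (hqd.trans h2)

/-! ### Permuting subgroups -/

/-- Two subgroups that permute have their set product as join. -/
lemma coe_sup_of_mul_comm {A B : Subgroup G} (h : (A : Set G) * (B : Set G) = (B : Set G) * A) :
    ((A ⊔ B : Subgroup G) : Set G) = (A : Set G) * (B : Set G) := by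
  let Y : Subgroup G :=
    { carrier := (A : Set G) * (B : Set G)
      mul_mem' := fun {x y} hx hy => by
        have : x * y ∈ ((A : Set G) * B) * ((A : Set G) * B) := Set.mul_mem_mul hx hy
        rwa [mul_assoc, ← mul_assoc (B : Set G), ← h, mul_assoc (A : Set G), coe_mul_coe,
          ← mul_assoc, coe_mul_coe] at this
      one_mem' := ⟨1, A.one_mem, 1, B.one_mem, one_mul 1⟩
      inv_mem' := fun {x} hx => by
        have : x⁻¹ ∈ ((A : Set G) * B)⁻¹ := Set.inv_mem_inv.2 hx
        rwa [mul_inv_rev, inv_coe_set, inv_coe_set, ← h] at this }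
  have hA : A ≤ Y := fun a ha => ⟨a, ha, 1, B.one_mem, mul_one a⟩
  have hB : B ≤ Y := fun b hb => ⟨1, A.one_mem, b, hb, one_mul b⟩
  apply Set.Subset.antisymm
  · exact (sup_le hA hB : A ⊔ B ≤ Y)
  · rintro _ ⟨a, ha, b, hb, rfl⟩
    exact Subgroup.mul_mem_sup ha hb

lemma relIndex_eq_of_coe_eq_mul [Finite G] {A B Y : Subgroup G}
    (h : (Y : Set G) = (B : Set G) * (A : Set G)) : A.relIndex Y = A.relIndex B := by
  have hB : B ≤ Y := fun b hb => by
    have : b ∈ (B : Set G) * (A : Set G) := ⟨b, hb, 1, A.one_mem, mul_one b⟩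
    rwa [← h] at this
  refine (Nat.card_congr (Equiv.ofBijective (Subgroup.quotientSubgroupOfEmbeddingOfLE A hB)
    ⟨(Subgroup.quotientSubgroupOfEmbeddingOfLE A hB).injective, fun y => ?_⟩)).symm
  induction y using QuotientGroup.induction_on with
  | H y =>
    have hy : (y : G) ∈ (B : Set G) * (A : Set G) := by rw [← h]; exact y.2
    obtain ⟨b, hb, a, ha, hba⟩ := hy
    refine ⟨QuotientGroup.mk ⟨b, hb⟩, ?_⟩
    rw [Subgroup.quotientSubgroupOfEmbeddingOfLE_apply_mk, QuotientGroup.eq]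
    have : b⁻¹ * (y : G) = a := by rw [← hba]; simp
    simpa [Subgroup.mem_subgroupOf, this] using ha

/-- Two subgroups of coprime index in `Y` have product `Y`. -/
lemma coe_eq_mul_of_coprime_relIndex [Finite G] {A B Y : Subgroup G} (hA : A ≤ Y) (hB : B ≤ Y)
    (h : (A.relIndex Y).Coprime (B.relIndex Y)) : (Y : Set G) = (B : Set G) * (A : Set G) := by
  have h1 : A.relIndex B * B.relIndex Y = (A ⊓ B).relIndex Y := by
    conv_rhs => rw [← Subgroup.relIndex_inf_mul_relIndex, inf_of_le_left hB]
  have h2 : A.relIndex Y ∣ A.relIndex B :=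
    h.dvd_of_dvd_mul_right (h1 ▸ Subgroup.relIndex_dvd_of_le_left Y inf_le_left)
  have hinj := (Subgroup.quotientSubgroupOfEmbeddingOfLE A hB).injective
  have hbij := (Nat.bijective_iff_injective_and_card
    (Subgroup.quotientSubgroupOfEmbeddingOfLE A hB)).2 ⟨hinj, le_antisymm
      (Nat.card_le_card_of_injective _ hinj)
      (Nat.le_of_dvd (Nat.pos_of_ne_zero (Subgroup.index_ne_zero_of_finite)) h2)⟩
  apply Set.Subset.antisymm
  · intro y hy
    obtain ⟨b, hb⟩ := hbij.2 (QuotientGroup.mk ⟨y, hy⟩)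
    induction b using QuotientGroup.induction_on with
    | H b =>
      rw [Subgroup.quotientSubgroupOfEmbeddingOfLE_apply_mk, QuotientGroup.eq] at hb
      refine ⟨b, b.2, (b : G)⁻¹ * y, ?_, by simp⟩
      simpa [Subgroup.mem_subgroupOf] using hb
  · rintro _ ⟨b, hb, a, ha, rfl⟩
    exact Y.mul_mem (hB hb) (hA ha)

/-! ### `S`-quasinormal subgroups -/

namespace IsSQuasinormal

lemma coe_sup {T : Subgroup G} (hT : IsSQuasinormal T) {q : ℕ} (hq : q.Prime) (Q : Sylow q G) :
    ((T ⊔ Q : Subgroup G) : Set G) = (Q : Set G) * (T : Set G) := by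
  rw [coe_sup_of_mul_comm (hT q hq Q)]
  exact hT q hq Q

lemma exists_relIndex_eq_pow [Finite G] {T : Subgroup G} (hT : IsSQuasinormal T) {q : ℕ}
    (hq : q.Prime) (Q : Sylow q G) : ∃ n : ℕ, T.relIndex (T ⊔ Q) = q ^ n := by
  have := Fact.mk hq
  rw [relIndex_eq_of_coe_eq_mul (hT.coe_sup hq Q)]
  exact Q.isPGroup'.index _

/-- For `T` `S`-quasinormal and `Q` a Sylow `q`-subgroup, the group `TQ` has the same `r`-subgroups
as `T` for `r ≠ q`: an `r`-subgroup lies in some `TR` with `R` a Sylow `r`-subgroup, and the indices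
of `T` in `TQ` and in `TR` are coprime. -/
lemma le_of_isPGroup [Finite G] {T : Subgroup G} (hT : IsSQuasinormal T) {q r : ℕ}
    (hq : q.Prime) (hr : r.Prime) (hne : r ≠ q) (Q : Sylow q G) {R : Subgroup G}
    (hR : IsPGroup r R) (hRQ : R ≤ T ⊔ Q) : R ≤ T := by
  obtain ⟨R', hR'⟩ := hR.exists_le_sylow
  obtain ⟨m, hm⟩ := hT.exists_relIndex_eq_pow hq Q
  obtain ⟨n, hn⟩ := hT.exists_relIndex_eq_pow hr R'
  have hle : T ≤ (T ⊔ Q) ⊓ (T ⊔ R') := le_inf le_sup_left le_sup_left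
  have h1 : T.relIndex ((T ⊔ Q) ⊓ (T ⊔ R')) ∣ q ^ m :=
    ⟨_, hm ▸ (Subgroup.relIndex_mul_relIndex _ _ _ hle inf_le_left).symm⟩
  have h2 : T.relIndex ((T ⊔ Q) ⊓ (T ⊔ R')) ∣ r ^ n :=
    ⟨_, hn ▸ (Subgroup.relIndex_mul_relIndex _ _ _ hle inf_le_right).symm⟩
  have h3 : T.relIndex ((T ⊔ Q) ⊓ (T ⊔ R')) = 1 := Nat.eq_one_of_dvd_coprimes
    (Nat.Coprime.pow m n ((Nat.coprime_primes hq hr).2 hne.symm)) h1 h2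
  exact (le_inf hRQ (hR'.trans le_sup_right)).trans (Subgroup.relIndex_eq_one.1 h3)

/-- The intersection of an `S`-quasinormal subgroup with a subgroup `M` is `S`-quasinormal
in `M`. -/
lemma subgroupOf [Finite G] {T : Subgroup G} (hT : IsSQuasinormal T) (M : Subgroup G) :
    IsSQuasinormal (T.subgroupOf M) := by
  intro q hq Q
  have := Fact.mk hq
  obtain ⟨Q', hQ'⟩ := (Q.isPGroup'.map M.subtype).exists_le_sylow
  set Y : Subgroup M := (T ⊔ Q').subgroupOf M with hY
  have hTY : T.subgroupOf M ≤ Y := Subgroup.comap_mono le_sup_left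
  have hQY : (Q : Subgroup M) ≤ Y := by
    rw [hY, Subgroup.subgroupOf, ← Subgroup.map_le_iff_le_comap]
    exact hQ'.trans le_sup_right
  -- A Sylow `r`-subgroup of `Y` with `r ≠ q` lies in `T`, so `r` does not divide the index.
  have h1 : ∀ r : ℕ, r.Prime → r ≠ q → ¬ r ∣ (T.subgroupOf M).relIndex Y := by
    intro r hr hne hd
    have := Fact.mk hr
    let S : Sylow r Y := default
    have hS : IsPGroup r (((S : Subgroup Y).map Y.subtype).map M.subtype) :=
      (S.isPGroup'.map _).map _
    have h2 : (((S : Subgroup Y).map Y.subtype).map M.subtype) ≤ T := by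
      refine hT.le_of_isPGroup hq hr hne Q' hS ?_
      rw [Subgroup.map_le_iff_le_comap, Subgroup.map_le_iff_le_comap]
      exact fun x _ => x.2
    have h3 : (S : Subgroup Y) ≤ (T.subgroupOf M).subgroupOf Y := by
      rwa [Subgroup.map_le_iff_le_comap, Subgroup.map_le_iff_le_comap] at h2
    exact S.not_dvd_index (hd.trans (Subgroup.index_dvd_of_le h3))
  have h2 : ¬ q ∣ (Q : Subgroup M).relIndex Y := fun hd =>
    Q.not_dvd_index (hd.trans (Subgroup.relIndex_dvd_index_of_le hQY))
  have h3 : ((T.subgroupOf M).relIndex Y).Coprime ((Q : Subgroup M).relIndex Y) := by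
    refine Nat.coprime_of_dvd fun r hr hd1 hd2 => ?_
    by_cases hrq : r = q
    · exact h2 (hrq ▸ hd2)
    · exact h1 r hr hrq hd1
  exact (coe_eq_mul_of_coprime_relIndex hQY hTY h3.symm).symm.trans
    (coe_eq_mul_of_coprime_relIndex hTY hQY h3)

lemma conj_smul {T : Subgroup G} (hT : IsSQuasinormal T) (g : G) :
    IsSQuasinormal (MulAut.conj g • T) := by
  intro q hq Q
  have h := congrArg (MulAut.conj g • ·) (hT q hq (g⁻¹ • Q))
  simp only [smul_mul', Sylow.coe_smul, map_inv, smul_inv_smul] at h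
  simpa using h

/-- The intersection of an `S`-quasinormal subgroup `T` with a normal `p`-subgroup `D` is normalised
by all `p'`-elements: if `Q` is a Sylow `q`-subgroup with `q ≠ p` then `T ∩ D = TQ ∩ D`. -/
lemma mem_normalizer_inf [Finite G] {p : ℕ} (hp : p.Prime) {T D : Subgroup G}
    (hT : IsSQuasinormal T) [D.Normal] (hD : IsPGroup p D) {y : G}
    (hy : p.Coprime (orderOf y)) : y ∈ Subgroup.normalizer ((T ⊓ D : Subgroup G) : Set G) := by
  refine mem_of_coprime_of_forall_prime_ne hp (fun q hq hne Q => ?_) hy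
  have h1 : T ⊓ D = (T ⊔ Q) ⊓ D := by
    refine le_antisymm (inf_le_inf_right _ le_sup_left) (le_inf ?_ inf_le_right)
    exact hT.le_of_isPGroup hq hp hne.symm Q hD.to_inf_right inf_le_left
  rw [h1]
  refine le_sup_right.trans (?_ : T ⊔ Q ≤ _)
  refine fun t ht => Subgroup.mem_normalizer_iff.2 fun x => and_congr ?_ ?_
  · exact Subgroup.mem_normalizer_iff.1 (Subgroup.le_normalizer ht) x
  · exact Subgroup.mem_normalizer_iff.1 (Subgroup.normalizer_eq_top (H := D) ▸ Subgroup.mem_top t)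
      x

end IsSQuasinormal

/-! ### The `p`-supersoluble hypercentre -/

/-- An element of order prime to `φ(|N|)` centralises a normal cyclic subgroup `N`, because
`φ(|N|)` is the order of the automorphism group of `N`. -/
lemma commute_of_isCyclic_of_coprime_totient [Finite G] (N : Subgroup G) [N.Normal] [IsCyclic N]
    {g n : G} (hg : (orderOf g).Coprime (Nat.card N).totient) (hn : n ∈ N) : Commute g n := by
  have h1 : orderOf (MulAut.conjNormal (H := N) g) ∣ (Nat.card N).totient := by
    rw [← IsCyclic.card_mulAut (G := N)]; exact orderOf_dvd_natCard _
  have h2 : MulAut.conjNormal (H := N) g = 1 :=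
    orderOf_eq_one_iff.1 (Nat.eq_one_of_dvd_coprimes hg
      (orderOf_map_dvd (MulAut.conjNormal (H := N)) g) h1)
  have h3 := MulAut.conjNormal_apply (H := N) g ⟨n, hn⟩
  rw [h2] at h3
  exact (mul_inv_eq_iff_eq_mul.1 h3.symm)

lemma relIndex_eq_card_factor (L K : Subgroup G) [K.Normal] :
    K.relIndex L = Nat.card (factor L K) := by
  conv_lhs => rw [← QuotientGroup.ker_mk' K]
  exact Subgroup.relIndex_ker L (QuotientGroup.mk' K)

/-- The kernel `L / K` of the semidirect product is one of its chief factors, so it has order `p`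
or prime to `p` if the semidirect product is `p`-supersoluble. -/
lemma IsChiefFactor.relIndex_of_isFCentral {p : ℕ} {L K : Subgroup G} [L.Normal] [K.Normal]
    (h : IsChiefFactor L K) (hF : IsPSupersoluble p (FactorSemidirect L K)) :
    K.relIndex L = p ∨ ¬ p ∣ K.relIndex L := by
  obtain ⟨-, -, hlt, hmin⟩ := h
  let φ := QuotientGroup.kerLift (conjAction L K)
  let A : Subgroup (FactorSemidirect L K) := (SemidirectProduct.inl (φ := φ)).range
  have hA : A.Normal := by
    have : A = (SemidirectProduct.rightHom (φ := φ)).ker :=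
      SemidirectProduct.range_inl_eq_ker_rightHom
    rw [this]; infer_instance
  have hcard : (⊥ : Subgroup (FactorSemidirect L K)).relIndex A = K.relIndex L := by
    rw [Subgroup.relIndex_bot_left, relIndex_eq_card_factor]
    exact (Nat.card_congr (MonoidHom.ofInjective SemidirectProduct.inl_injective).toEquiv).symm
  rw [← hcard]
  refine hF A ⊥ ⟨hA, inferInstance, ?_, ?_⟩
  · rw [bot_lt_iff_ne_bot]
    intro hbot
    rw [hbot, Subgroup.relIndex_self] at hcard
    exact hlt.not_ge (Subgroup.relIndex_eq_one.1 hcard.symm)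
  · intro N hN _ hNA
    -- The normal subgroup of `G` between `K` and `L` that corresponds to `N`.
    let N' : Subgroup G := ((N.comap (SemidirectProduct.inl (φ := φ))).map
      (factor L K).subtype).comap (QuotientGroup.mk' K)
    have hmem : ∀ f : factor L K, ∀ x : G, (x : G ⧸ K) = f →
        (x ∈ N' ↔ SemidirectProduct.inl (φ := φ) f ∈ N) := by
      intro f x hx
      constructor
      · rintro ⟨f', hf', hxf⟩
        have : f' = f := Subtype.ext (hxf.trans hx)
        exact this ▸ hf'
      · intro hf
        exact ⟨f, hf, hx.symm⟩
    have hKN : K ≤ N' := fun x hx => by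
      rw [hmem 1 x ((QuotientGroup.eq_one_iff x).2 hx), map_one]
      exact N.one_mem
    have hLK : ∀ x : G, (x : G ⧸ K) ∈ factor L K → x ∈ L := by
      rintro x ⟨l, hl, hlx⟩
      have h1 : l⁻¹ * x ∈ K := QuotientGroup.eq.1 hlx
      have := L.mul_mem hl (hlt.le h1)
      simpa using this
    have hNL : N' ≤ L := by
      rintro x ⟨f, -, hfx⟩
      refine hLK x ?_
      have : (x : G ⧸ K) = f := hfx.symm
      rw [this]; exact f.2
    have hN' : N'.Normal := by
      refine ⟨fun x hx g => ?_⟩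
      have hxf : (x : G ⧸ K) ∈ factor L K := ⟨x, hNL hx, rfl⟩
      have h1 := (hmem ⟨_, hxf⟩ x rfl).1 hx
      rw [hmem (conjAction L K g ⟨_, hxf⟩) (g * x * g⁻¹)]
      · have h2 := hN.conj_mem _ h1 (SemidirectProduct.inr (φ := φ) (QuotientGroup.mk g))
        rwa [← map_inv, ← SemidirectProduct.inl_aut] at h2
      · simp [conjAction]
    rcases hmin N' hN' hKN hNL with h1 | h1
    · left
      rw [eq_bot_iff]
      intro y hy
      obtain ⟨f, rfl⟩ := hNA hy
      obtain ⟨_, x, hx, rfl⟩ := f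
      have h2 := (hmem ⟨_, x, hx, rfl⟩ x rfl).2 hy
      rw [h1] at h2
      have h3 : (⟨_, x, hx, rfl⟩ : factor L K) = 1 :=
        Subtype.ext ((QuotientGroup.eq_one_iff x).2 h2)
      rw [Subgroup.mem_bot, h3, map_one]
    · right
      refine le_antisymm hNA ?_
      rintro _ ⟨⟨_, x, hx, rfl⟩, rfl⟩
      exact (hmem ⟨_, x, hx, rfl⟩ x rfl).1 (h1 ▸ hx)

/-- The normal subgroups of `G` that have a series of normal subgroups of `G`, starting at the
trivial group, each of whose factors has order prime to `p` or is centralised by `G`. -/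
inductive HasCentralSeries (p : ℕ) : Subgroup G → Prop
  | bot : HasCentralSeries p ⊥
  | step {K N : Subgroup G} (hK : HasCentralSeries p K) (hN : N.Normal) (hKN : K ≤ N)
      (h : ¬ p ∣ K.relIndex N ∨ ⁅N, (⊤ : Subgroup G)⁆ ≤ K) : HasCentralSeries p N

namespace HasCentralSeries

lemma normal {p : ℕ} {N : Subgroup G} (h : HasCentralSeries p N) : N.Normal := by
  cases h with
  | bot => infer_instance
  | step _ hN _ _ => exact hN

lemma sup {p : ℕ} {A B : Subgroup G} (hA : HasCentralSeries p A) (hB : HasCentralSeries p B) :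
    HasCentralSeries p (A ⊔ B) := by
  induction hB with
  | bot => rwa [sup_bot_eq]
  | @step K N hK hN hKN h ih =>
    have hAn := hA.normal
    have hKn := hK.normal
    refine .step ih inferInstance (sup_le_sup_left hKN A) (h.imp (fun h => ?_) fun h => ?_)
    · have h1 : A ⊔ N = (A ⊔ K) ⊔ N := by rw [sup_assoc, sup_eq_right.2 hKN]
      rw [h1, Subgroup.relIndex_sup_left]
      exact fun hd => h <| hd.trans (Subgroup.relIndex_dvd_of_le_left _ le_sup_right)
    · rw [Subgroup.commutator_le]
      intro x hx g _
      obtain ⟨a, ha, n, hn, rfl⟩ := Subgroup.mem_sup_of_normal_left.1 hx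
      have h1 : (a : G ⧸ A ⊔ K) = 1 := (QuotientGroup.eq_one_iff a).2 (Subgroup.mem_sup_left ha)
      have h2 : n * g * n⁻¹ * g⁻¹ ∈ A ⊔ K := Subgroup.mem_sup_right
        (h (Subgroup.commutator_mem_commutator hn (Subgroup.mem_top g)))
      rw [← QuotientGroup.eq_one_iff] at h2 ⊢
      rw [← h2]
      simp only [commutatorElement_def, QuotientGroup.mk_mul, QuotientGroup.mk_inv, h1, one_mul]

lemma sSup [Finite G] {p : ℕ} {S : Set (Subgroup G)} (hS : ∀ N ∈ S, HasCentralSeries p N) :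
    HasCentralSeries p (sSup S) := by
  induction S, S.toFinite using Set.Finite.induction_on with
  | empty => rw [sSup_empty]; exact .bot
  | insert _ _ ih =>
    rw [sSup_insert]
    exact (hS _ (Set.mem_insert _ _)).sup (ih fun N hN => hS N (Set.mem_insert_of_mem _ hN))

/-- A `p'`-element that normalises a `p`-subgroup `D` centralises the part of `D` inside a subgroup
with a central series: it acts trivially on every factor of the induced series of `D`. -/
lemma commute [Finite G] {p : ℕ} (hp : p.Prime) {N : Subgroup G} (hN : HasCentralSeries p N)
    {D : Subgroup G} (hD : IsPGroup p D) {y : G} (hy : p.Coprime (orderOf y))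
    (hyD : ∀ d ∈ D, y * d * y⁻¹ ∈ D) : ∀ d ∈ D, d ∈ N → Commute y d := by
  induction hN with
  | bot =>
    rintro d - hd
    rw [Subgroup.mem_bot.1 hd]; exact Commute.one_right y
  | @step K N hK hN hKN h ih =>
    intro d hdD hdN
    rcases h with h | h
    · refine ih d hdD ?_
      have hKn := hK.normal
      have h1 : d ^ K.relIndex N ∈ K := by
        exact Subgroup.pow_index_mem (K.subgroupOf N) ⟨d, hdN⟩
      obtain ⟨k, hk⟩ := hD ⟨d, hdD⟩
      have h2 : d ^ p ^ k = 1 := by simpa [Subtype.ext_iff] using hk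
      rw [← QuotientGroup.eq_one_iff, QuotientGroup.mk_pow] at h1
      rw [← QuotientGroup.eq_one_iff, ← orderOf_eq_one_iff]
      have h3 : (d : G ⧸ K) ^ p ^ k = 1 := by rw [← QuotientGroup.mk_pow, h2, QuotientGroup.mk_one]
      exact Nat.eq_one_of_dvd_coprimes (((Nat.Prime.coprime_iff_not_dvd hp).2 h).pow_left k)
        (orderOf_dvd_of_pow_eq_one h3) (orderOf_dvd_of_pow_eq_one h1)
    · have hkD : d⁻¹ * (y * d * y⁻¹) ∈ D := D.mul_mem (D.inv_mem hdD) (hyD d hdD)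
      have hkK : d⁻¹ * (y * d * y⁻¹) ∈ K := by
        have := h (Subgroup.commutator_mem_commutator (N.inv_mem hdN) (Subgroup.mem_top y))
        rw [commutatorElement_def, inv_inv] at this
        simpa [mul_assoc] using this
      exact commute_of_commutator_commute hD hy hkD (ih _ hkD hkK) (by group)

end HasCentralSeries

lemma IsFHypercentral.hasCentralSeries [Finite G] {p : ℕ} (hp : p.Prime)
    (hcop : (Nat.card G).Coprime (p - 1)) (N : Subgroup G)
    (hN : IsFHypercentral (fun X [Group X] => IsPSupersoluble p X) N) :
    HasCentralSeries p N := by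
  induction N using WellFoundedLT.induction with
  | ind N ih =>
    obtain ⟨hNn, hN⟩ := hN
    by_cases hbot : N = ⊥
    · rw [hbot]; exact .bot
    obtain ⟨K, hK⟩ := (Set.toFinite {K : Subgroup G | K.Normal ∧ K < N}).exists_maximal
      ⟨⊥, inferInstance, bot_lt_iff_ne_bot.2 hbot⟩
    obtain ⟨hKn, hKN⟩ := hK.prop
    have hchief : IsChiefFactor N K := by
      refine ⟨hNn, hKn, hKN, fun M hM hKM hMN => ?_⟩
      by_cases h : M = N
      · exact Or.inr h
      · exact Or.inl (le_antisymm (hK.2 ⟨hM, lt_of_le_of_ne hMN h⟩ hKM) hKM)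
    refine .step (ih K hKN ⟨hKn, fun L K' _ _ h hL => hN L K' h (hL.trans hKN.le)⟩) hNn hKN.le ?_
    rcases hchief.relIndex_of_isFCentral (hN N K hchief le_rfl) with h | h
    · right
      rw [relIndex_eq_card_factor] at h
      have := Fact.mk hp
      have hcyc : IsCyclic (factor N K) := isCyclic_of_prime_card h
      rw [Subgroup.commutator_le]
      intro n hn g _
      rw [← QuotientGroup.eq_one_iff]
      have h1 : Commute (g : G ⧸ K) n := by
        refine commute_of_isCyclic_of_coprime_totient (factor N K) ?_ ⟨n, hn, rfl⟩
        rw [h, Nat.totient_prime hp]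
        exact hcop.coprime_dvd_left ((orderOf_map_dvd (QuotientGroup.mk' K) g).trans
          (orderOf_dvd_natCard g))
      exact commutatorElement_eq_one_iff_commute.2 h1.symm
    · exact Or.inl h

lemma hasCentralSeries_fHypercentre [Finite G] {p : ℕ} (hp : p.Prime)
    (hcop : (Nat.card G).Coprime (p - 1)) :
    HasCentralSeries p (FHypercentre (fun X [Group X] => IsPSupersoluble p X) G) :=
  HasCentralSeries.sSup fun N hN => IsFHypercentral.hasCentralSeries hp hcop N hN

/-! ### A condition that passes to subgroups -/

/-- A consequence of weak `(𝔘_p)_s`-quasinormality that, unlike it, is plainly inherited by the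
subgroups of `G` that contain `H`. The condition on the hypercentre is replaced by its effect on
`p`-subgroups, modulo a normal subgroup `C` of `G` inside `H`. -/
def IsCentrallyEmbedded (p : ℕ) (H : Subgroup G) : Prop :=
  ∃ T R C : Subgroup G, IsSQuasinormal T ∧ IsSQuasinormal R ∧ (R : Set G) = (H : Set G) * T ∧
    C.Normal ∧ C ≤ H ∧ ∀ D : Subgroup G, IsPGroup p D → ∀ y : G, p.Coprime (orderOf y) →
      (∀ d ∈ D, y * d * y⁻¹ ∈ D) → ∀ d ∈ D, d ∈ H → d ∈ T → d⁻¹ * (y * d * y⁻¹) ∈ C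

lemma IsWeaklyFsQuasinormal.isCentrallyEmbedded [Finite G] {p : ℕ} (hp : p.Prime)
    (hcop : (Nat.card G).Coprime (p - 1)) {H : Subgroup G}
    (h : IsWeaklyFsQuasinormal (fun X [Group X] => IsPSupersoluble p X) H) :
    IsCentrallyEmbedded p H := by
  obtain ⟨T, hT, ⟨R, hRT, hR⟩, hZ⟩ := h
  refine ⟨T, R, H.normalCore, hT, hR, hRT, inferInstance, H.normalCore_le, ?_⟩
  intro D hD y hy hyD d hdD hdH hdT
  have hcop' : (Nat.card (G ⧸ H.normalCore)).Coprime (p - 1) :=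
    hcop.coprime_dvd_left (Subgroup.card_quotient_dvd_card _)
  have h1 := (hasCentralSeries_fHypercentre (G := G ⧸ H.normalCore) hp hcop').commute hp
    (hD.map (QuotientGroup.mk' H.normalCore)) (y := (y : G ⧸ H.normalCore))
    (hy.coprime_dvd_right (orderOf_map_dvd (QuotientGroup.mk' _) y))
    (by
      rintro _ ⟨d, hd, rfl⟩
      exact ⟨_, hyD d hd, rfl⟩) d ⟨d, hdD, rfl⟩
    (hZ ⟨d, Subgroup.mem_sup_left ⟨hdH, hdT⟩, rfl⟩)
  rw [← QuotientGroup.eq_one_iff]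
  have h2 : (d : G ⧸ H.normalCore)⁻¹ * (y * d * (y : G ⧸ H.normalCore)⁻¹) = 1 := by
    rw [h1.eq]; group
  exact h2

namespace IsCentrallyEmbedded

lemma subgroupOf [Finite G] {p : ℕ} {H M : Subgroup G} (h : IsCentrallyEmbedded p H) (hHM : H ≤ M) :
    IsCentrallyEmbedded p (H.subgroupOf M) := by
  obtain ⟨T, R, C, hT, hR, hRT, hC, hCH, h⟩ := h
  refine ⟨T.subgroupOf M, R.subgroupOf M, C.subgroupOf M, hT.subgroupOf M, hR.subgroupOf M, ?_,
    inferInstance, Subgroup.comap_mono hCH, ?_⟩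
  · ext x
    constructor
    · intro hx
      have hx' : (x : G) ∈ (H : Set G) * T := hRT ▸ hx
      obtain ⟨a, ha, t, ht, hat⟩ := hx'
      have htM : t ∈ M := by
        have : t = a⁻¹ * x := by rw [← hat]; simp
        rw [this]; exact M.mul_mem (M.inv_mem (hHM ha)) x.2
      exact ⟨⟨a, hHM ha⟩, ha, ⟨t, htM⟩, ht, Subtype.ext hat⟩
    · rintro ⟨a, ha, t, ht, rfl⟩
      have : ((a : G) * t) ∈ (H : Set G) * T := ⟨a, ha, t, ht, rfl⟩
      rw [← hRT] at this
      exact this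
  · intro D hD y hy hyD d hdD hdH hdT
    refine h (D.map M.subtype) (hD.map _) y (by simpa using hy) ?_ d ⟨d, hdD, rfl⟩ hdH hdT
    rintro _ ⟨d, hd, rfl⟩
    exact ⟨_, hyD d hd, rfl⟩

lemma conj_smul [Finite G] {p : ℕ} {H : Subgroup G} (h : IsCentrallyEmbedded p H) (g : G) :
    IsCentrallyEmbedded p (MulAut.conj g • H) := by
  obtain ⟨T, R, C, hT, hR, hRT, hC, hCH, h⟩ := h
  refine ⟨MulAut.conj g • T, MulAut.conj g • R, C, hT.conj_smul g, hR.conj_smul g, ?_, hC, ?_, ?_⟩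
  · have := congrArg (MulAut.conj g • ·) hRT
    simpa only [smul_mul', Subgroup.coe_pointwise_smul] using this
  · rw [← Subgroup.Normal.conj_smul_eq_self g C]
    exact Subgroup.pointwise_smul_le_pointwise_smul_iff.2 hCH
  · intro D hD y hy hyD d hdD hdH hdT
    rw [Subgroup.mem_pointwise_smul_iff_inv_smul_mem] at hdH hdT
    have h1 := h (MulAut.conj g⁻¹ • D) (hD.map _) (g⁻¹ * y * g) ?_ ?_ (g⁻¹ * d * g) ?_ ?_ ?_
    · have h2 := hC.conj_mem _ h1 g
      convert h2 using 1
      group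
    · have : orderOf (g⁻¹ * y * g) = orderOf y := by
        simpa using orderOf_conj_eq g⁻¹ y
      rwa [this]
    · intro e he
      rw [Subgroup.mem_pointwise_smul_iff_inv_smul_mem] at he ⊢
      have := hyD _ he
      simp only [map_inv, inv_inv, MulAut.smul_def, MulAut.conj_apply] at this ⊢
      convert this using 1
      group
    · rw [Subgroup.mem_pointwise_smul_iff_inv_smul_mem]
      simpa [mul_assoc] using hdD
    · simpa [mul_assoc] using hdH
    · simpa [mul_assoc] using hdT

end IsCentrallyEmbedded

namespace HasPNilpotentSupplement

lemma subgroupOf [Finite G] {p : ℕ} (hp : p.Prime) {H M : Subgroup G}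
    (h : HasPNilpotentSupplement p H) (hHM : H ≤ M) :
    HasPNilpotentSupplement p (H.subgroupOf M) := by
  obtain ⟨K, hK, hKp⟩ := h
  refine ⟨K.subgroupOf M, ?_, ?_⟩
  · rw [Set.eq_univ_iff_forall] at hK ⊢
    intro x
    obtain ⟨a, ha, k, hk, hak⟩ := hK x
    have hkM : k ∈ M := by
      have : k = a⁻¹ * x := by rw [← hak]; simp
      rw [this]; exact M.mul_mem (M.inv_mem (hHM ha)) x.2
    exact ⟨⟨a, hHM ha⟩, ha, ⟨k, hkM⟩, hk, Subtype.ext hak⟩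
  · rw [isPNilpotent_iff hp] at hKp ⊢
    intro x y hx hy
    have h1 := hKp ⟨_, x.2⟩ ⟨_, y.2⟩ (by simpa using hx) (by simpa using hy)
    rw [← Subgroup.orderOf_coe, ← Subgroup.orderOf_coe]
    rwa [← Subgroup.orderOf_coe] at h1

lemma of_conj_smul {p : ℕ} {H : Subgroup G} {g : G}
    (h : HasPNilpotentSupplement p (MulAut.conj g • H)) : HasPNilpotentSupplement p H := by
  obtain ⟨K, hK, hKp⟩ := h
  refine ⟨K, ?_, hKp⟩
  rw [Set.eq_univ_iff_forall] at hK ⊢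
  intro x
  obtain ⟨a, ha, k, hk, h1⟩ := hK (g * x)
  obtain ⟨b, hb, l, hl, h2⟩ := hK g
  rw [SetLike.mem_coe, Subgroup.mem_pointwise_smul_iff_inv_smul_mem] at ha hb
  simp only [MulAut.smul_def, MulAut.inv_apply, MulAut.conj_symm_apply] at ha hb
  refine ⟨(g⁻¹ * a * g) * (g⁻¹ * b * g)⁻¹, H.mul_mem ha (H.inv_mem hb), l⁻¹ * k,
    K.mul_mem (K.inv_mem hl) hk, ?_⟩
  have h3 : x = g⁻¹ * (a * k) := by
    have h1' : a * k = g * x := h1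
    rw [h1']; group
  have h4 : b⁻¹ * g = l := by
    have h2' : b * l = g := h2
    rw [← h2']; group
  simp only
  rw [h3, ← h4]
  group

end HasPNilpotentSupplement

/-! ### Fusion and transfer -/

/-- Normalisers grow in finite `p`-groups. -/
lemma exists_mem_normalizer_of_lt [Finite G] {p : ℕ} (hp : p.Prime) {P D : Subgroup G}
    (hP : IsPGroup p P) (hDP : D < P) :
    ∃ x ∈ P, x ∉ D ∧ x ∈ Subgroup.normalizer (D : Set G) := by
  have := Fact.mk hp
  have := hP.isNilpotent
  have h1 : D.subgroupOf P < ⊤ := by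
    rw [lt_top_iff_ne_top, Ne, Subgroup.subgroupOf_eq_top]
    exact hDP.not_ge
  obtain ⟨-, x, hx, hxD⟩ := SetLike.lt_iff_le_and_exists.1
    (Group.normalizerCondition_of_isNilpotent _ h1)
  refine ⟨x, x.2, hxD, ?_⟩
  rw [Subgroup.mem_normalizer_iff] at hx ⊢
  intro d
  constructor
  · intro hd
    exact (hx ⟨d, hDP.le hd⟩).1 hd
  · intro hd
    have hdP : d ∈ P := by
      have := P.mul_mem (P.mul_mem (P.inv_mem x.2) (hDP.le hd)) x.2
      simpa [mul_assoc] using this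
    exact (hx ⟨d, hdP⟩).2 hd

/-- A `p`-nilpotent group is the product of its `p'`-elements and any Sylow `p`-subgroup. -/
lemma IsPNilpotent.exists_eq_mul [Finite G] {p : ℕ} (hp : p.Prime) (h : IsPNilpotent p G)
    (P : Sylow p G) (g : G) : ∃ k, p.Coprime (orderOf k) ∧ ∃ r ∈ P, g = k * r := by
  have := Fact.mk hp
  obtain ⟨K, hK, hcard, hq⟩ := h
  obtain ⟨n, hn⟩ := hq.exists_card_eq
  have h1 : K ⊔ P = ⊤ := by
    rw [← Subgroup.index_eq_one]
    have h2 : (K ⊔ P).index ∣ p ^ n := hn ▸ Subgroup.index_dvd_of_le le_sup_left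
    have h3 : p.Coprime (K ⊔ P).index := (Nat.Prime.coprime_iff_not_dvd hp).2 fun hd =>
      P.not_dvd_index (hd.trans (Subgroup.index_dvd_of_le le_sup_right))
    exact Nat.eq_one_of_dvd_coprimes (h3.pow_left n) h2 dvd_rfl
  obtain ⟨k, hk, r, hr, hkr⟩ := Subgroup.mem_sup_of_normal_left.1 (h1 ▸ Subgroup.mem_top g)
  exact ⟨k, ((Nat.Prime.coprime_iff_not_dvd hp).2 hcard).coprime_dvd_right
    (Subgroup.orderOf_dvd_natCard K hk), r, hr, hkr.symm⟩

/-- If the normalisers of the non-central `p`-subgroups are `p`-nilpotent, any two Sylow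
`p`-subgroups are conjugate by an element that centralises their intersection. -/
lemma exists_smul_eq_of_isPNilpotent_normalizer [Finite G] {p : ℕ} (hp : p.Prime)
    (hloc : ∀ D : Subgroup G, IsPGroup p D → D ≤ Subgroup.center G ∨
      IsPNilpotent p (Subgroup.normalizer (D : Set G))) (P Q : Sylow p G) :
    ∃ c : G, (∀ d ∈ P, d ∈ Q → Commute c d) ∧ c • P = Q := by
  have := Fact.mk hp
  induction hD : (P ⊓ Q : Subgroup G) using WellFoundedGT.induction generalizing P Q with
  | ind D ih =>
    by_cases hPQ : P = Q
    · exact ⟨1, fun d _ _ => Commute.one_left d, by rw [one_smul, hPQ]⟩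
    have hDpg : IsPGroup p D := hD ▸ P.isPGroup'.to_inf_left
    have hDP : D < P := by
      refine lt_of_le_of_ne (hD ▸ inf_le_left) fun h => hPQ ?_
      exact (Sylow.ext (P.is_maximal' Q.isPGroup' (by rw [← h, ← hD]; exact inf_le_right))).symm
    have hDQ : D < Q := by
      refine lt_of_le_of_ne (hD ▸ inf_le_right) fun h => hPQ ?_
      exact Sylow.ext (Q.is_maximal' P.isPGroup' (by rw [← h, ← hD]; exact inf_le_left))
    rcases hloc D hDpg with hc | hnil
    · obtain ⟨c, hc'⟩ := MulAction.exists_smul_eq G P Q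
      refine ⟨c, fun d hdP hdQ => ?_, hc'⟩
      exact Subgroup.mem_center_iff.1 (hc (hD ▸ ⟨hdP, hdQ⟩)) c
    set N : Subgroup G := Subgroup.normalizer (D : Set G) with hN
    obtain ⟨R₁, hR₁⟩ := (P.isPGroup'.comap_subtype (K := N)).exists_le_sylow
    obtain ⟨R₂, hR₂⟩ := (Q.isPGroup'.comap_subtype (K := N)).exists_le_sylow
    obtain ⟨n, hn⟩ := MulAction.exists_smul_eq N R₁ R₂
    obtain ⟨k, hk, r, hr, rfl⟩ := hnil.exists_eq_mul hp R₁ n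
    rw [mul_smul, Sylow.smul_eq_iff_mem_normalizer.2 (Subgroup.le_normalizer hr)] at hn
    obtain ⟨S, hS⟩ := (R₁.isPGroup'.map N.subtype).exists_le_sylow
    obtain ⟨x, hxP, hxD, hxN⟩ := exists_mem_normalizer_of_lt hp P.isPGroup' hDP
    obtain ⟨y, hyQ, hyD, hyN⟩ := exists_mem_normalizer_of_lt hp Q.isPGroup' hDQ
    have hDN : D ≤ N := Subgroup.le_normalizer
    have hPS : ∀ z ∈ P, z ∈ N → z ∈ S := fun z hzP hzN =>
      hS ⟨⟨z, hzN⟩, hR₁ hzP, rfl⟩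
    have hQS : ∀ z ∈ Q, z ∈ N → z ∈ (k : G) • S := by
      intro z hzQ hzN
      have h1 : (⟨z, hzN⟩ : N) ∈ R₂ := hR₂ hzQ
      rw [← hn, ← SetLike.mem_coe, Sylow.coe_smul, Set.mem_smul_set_iff_inv_smul_mem] at h1
      rw [← SetLike.mem_coe, Sylow.coe_smul, Set.mem_smul_set_iff_inv_smul_mem]
      exact hS ⟨_, h1, rfl⟩
    obtain ⟨c₁, hc₁, hc₁'⟩ := ih (P ⊓ S : Subgroup G) (by
      refine lt_of_le_of_ne (fun d hd => ⟨hDP.le hd, hPS d (hDP.le hd) (hDN hd)⟩) ?_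
      rintro h
      exact hxD (h ▸ ⟨hxP, hPS x hxP hxN⟩)) P S rfl
    obtain ⟨c₂, hc₂, hc₂'⟩ := ih (((k : G) • S : Sylow p G) ⊓ Q : Subgroup G) (by
      refine lt_of_le_of_ne (fun d hd => ⟨hQS d (hDQ.le hd) (hDN hd), hDQ.le hd⟩) ?_
      rintro h
      exact hyD (h ▸ ⟨hQS y hyQ hyN, hyQ⟩)) ((k : G) • S) Q rfl
    refine ⟨c₂ * k * c₁, fun d hdP hdQ => ?_, by rw [mul_smul, mul_smul, hc₁', hc₂']⟩
    have hdD : d ∈ D := hD ▸ ⟨hdP, hdQ⟩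
    refine Commute.mul_left (Commute.mul_left ?_ ?_) ?_
    · exact hc₂ d (hQS d hdQ (hDN hdD)) hdQ
    · exact hnil.commute hp hDpg hDN k.2 k.2 (by simpa using hk) hdD
    · exact hc₁ d hdP (hPS d hdP (hDN hdD))

/-- Under the same hypothesis, elements of a Sylow `p`-subgroup `P` that are conjugate in `G` are
conjugate in `P`. -/
lemma exists_conj_eq_of_isPNilpotent_normalizer [Finite G] {p : ℕ} (hp : p.Prime)
    (hloc : ∀ D : Subgroup G, IsPGroup p D → D ≤ Subgroup.center G ∨
      IsPNilpotent p (Subgroup.normalizer (D : Set G))) (P : Sylow p G) {x g : G} (hx : x ∈ P)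
    (hgx : g * x * g⁻¹ ∈ P) : ∃ u ∈ P, u * x * u⁻¹ = g * x * g⁻¹ := by
  obtain ⟨c, hc, hcP⟩ := exists_smul_eq_of_isPNilpotent_normalizer hp hloc P (g⁻¹ • P)
  have hxQ : x ∈ g⁻¹ • P := by
    rw [← SetLike.mem_coe, Sylow.coe_smul, Set.mem_smul_set_iff_inv_smul_mem]
    simpa using hgx
  have hcx : Commute c x := hc x hx hxQ
  have hn : g * c ∈ Subgroup.normalizer (P : Set G) := by
    rw [← Sylow.smul_eq_iff_mem_normalizer, mul_smul, hcP, smul_inv_smul]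
  have hnx : (g * c) * x * (g * c)⁻¹ = g * x * g⁻¹ := by
    rw [mul_assoc g c x, hcx.eq]; group
  rcases hloc P P.isPGroup' with h | h
  · refine ⟨1, P.one_mem, ?_⟩
    have := Subgroup.mem_center_iff.1 (h hx) g
    rw [this]; group
  · obtain ⟨k, hk, r, hr, hkr⟩ := h.exists_eq_mul hp (P.subtype Subgroup.le_normalizer) ⟨_, hn⟩
    have hrP : (r : G) ∈ P := hr
    refine ⟨r, hrP, ?_⟩
    have h1 : r * x * (r : G)⁻¹ ∈ P := P.mul_mem (P.mul_mem hrP hx) (P.inv_mem hrP)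
    have h2 := h.commute hp P.isPGroup' Subgroup.le_normalizer k.2 k.2 (by simpa using hk) h1
    have h3 : g * c = k * r := congrArg Subtype.val hkr
    rw [← hnx, h3]
    calc (r : G) * x * (r : G)⁻¹ = (k * (r * x * (r : G)⁻¹)) * (k : G)⁻¹ := by rw [h2.eq]; group
      _ = _ := by group

/-- If a Sylow `p`-subgroup `P` controls its own fusion and `G` has no proper normal subgroup of
`p`-power index, then the transfer of `G` into `P / P'` shows that `P` is trivial. -/
lemma not_dvd_card_of_forall_conj [Finite G] {p : ℕ} (hp : p.Prime) (P : Sylow p G)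
    (hfus : ∀ x g : G, x ∈ P → g * x * g⁻¹ ∈ P → ∃ u ∈ P, u * x * u⁻¹ = g * x * g⁻¹)
    (hperf : ∀ N : Subgroup G, ∀ _ : N.Normal, IsPGroup p (G ⧸ N) → N = ⊤) :
    ¬ p ∣ Nat.card G := by
  classical
  have := Fact.mk hp
  let φ : P →* Abelianization P := Abelianization.of
  let τ : G →* Abelianization P := MonoidHom.transfer φ
  have hτ : τ.ker = ⊤ := hperf _ inferInstance <|
    ((P.isPGroup'.of_surjective φ (QuotientGroup.mk'_surjective _)).to_subgroup τ.range).of_equiv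
      (QuotientGroup.quotientKerEquivRange τ).symm
  have hφ : ∀ x y : P, (∃ u : P, u * x * u⁻¹ = y) → φ y = φ x := by
    rintro x y ⟨u, rfl⟩
    rw [map_mul, map_mul, map_inv, mul_comm (φ u), mul_inv_cancel_right]
  have hval : ∀ x : P, τ x = φ x ^ (P : Subgroup G).index := by
    intro x
    let := (P : Subgroup G).fintypeQuotientOfFiniteIndex
    have h1 : τ x = _ := MonoidHom.transfer_eq_prod_quotient_orbitRel_zpowers_quot φ (x : G)
    rw [h1, Subgroup.index_eq_sum_minimalPeriod (P : Subgroup G) (x : G),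
      ← Finset.prod_pow_eq_pow_sum]
    refine Finset.prod_congr rfl fun q _ => ?_
    rw [← map_pow]
    refine hφ _ _ ?_
    have hm := QuotientGroup.out_conj_pow_minimalPeriod_mem (P : Subgroup G) (x : G) q.out
    obtain ⟨u, hu, hux⟩ := hfus ((x : G) ^ Function.minimalPeriod ((x : G) • ·) q.out) q.out.out⁻¹
      (P.pow_mem x.2 _) (by rw [inv_inv]; exact hm)
    exact ⟨⟨u, hu⟩, Subtype.ext (by simpa using hux)⟩
  have htriv : ∀ x : P, φ x = 1 := by
    intro x
    have h1 : φ x ^ (P : Subgroup G).index = 1 := by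
      rw [← hval]
      exact MonoidHom.mem_ker.1 (hτ ▸ Subgroup.mem_top (x : G))
    obtain ⟨k, hk⟩ := P.isPGroup' x
    have h2 : φ x ^ p ^ k = 1 := by rw [← map_pow, hk, map_one]
    rw [← orderOf_eq_one_iff]
    exact Nat.eq_one_of_dvd_coprimes
      (((Nat.Prime.coprime_iff_not_dvd hp).2 P.not_dvd_index).pow_left k)
      (orderOf_dvd_of_pow_eq_one h2) (orderOf_dvd_of_pow_eq_one h1)
  intro hd
  have hnt : Nontrivial P := by
    rw [← Finite.one_lt_card_iff_nontrivial]
    exact hp.one_lt.trans_le (Nat.le_of_dvd Nat.card_pos (P.dvd_card_of_dvd_card hd))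
  have := P.isPGroup'.isNilpotent
  refine (Group.IsSolvable.commutator_lt_top_of_nontrivial P).ne ?_
  rw [eq_top_iff]
  intro x _
  rw [← Abelianization.ker_of]
  exact htriv x

/-! ### Minimal non-`p`-nilpotent groups -/

/-- A subgroup that contains all `p'`-elements is the whole group, if there is no proper normal
subgroup of `p`-power index. -/
lemma eq_top_of_forall_coprime_mem [Finite G] {p : ℕ} (hp : p.Prime)
    (hperf : ∀ N : Subgroup G, ∀ _ : N.Normal, IsPGroup p (G ⧸ N) → N = ⊤) {M : Subgroup G}
    (hM : ∀ x : G, p.Coprime (orderOf x) → x ∈ M) : M = ⊤ := by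
  have h1 : M.normalCore = ⊤ := hperf _ inferInstance <|
    isPGroup_quotient_of_forall_mem hp fun x hx g => by
      refine hM _ ?_
      rwa [orderOf_conj_eq]
  exact top_le_iff.1 (h1 ▸ M.normalCore_le)

/-- A minimal non-`p`-nilpotent group has a normal `p`-subgroup that some `p'`-element does not
centralise; otherwise Sylow `p`-subgroups control their fusion and transfer applies. -/
lemma exists_normal_not_commute [Finite G] {p : ℕ} (hp : p.Prime) (hG : ¬ IsPNilpotent p G)
    (hmin : ∀ M : Subgroup G, M ≠ ⊤ → IsPNilpotent p M)
    (hperf : ∀ N : Subgroup G, ∀ _ : N.Normal, IsPGroup p (G ⧸ N) → N = ⊤) :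
    ∃ D : Subgroup G, D.Normal ∧ IsPGroup p D ∧ ∃ g : G, p.Coprime (orderOf g) ∧
      ∃ d ∈ D, ¬ Commute g d := by
  have := Fact.mk hp
  by_contra! hcon
  refine hG ⟨⊤, inferInstance, ?_, ?_⟩
  · rw [Subgroup.card_top]
    obtain ⟨P⟩ : Nonempty (Sylow p G) := inferInstance
    refine not_dvd_card_of_forall_conj hp P (fun x g hx hgx => ?_) hperf
    refine exists_conj_eq_of_isPNilpotent_normalizer hp (fun D hD => ?_) P hx hgx
    by_cases hDn : Subgroup.normalizer (D : Set G) = ⊤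
    · left
      have hc : Subgroup.centralizer (D : Set G) = ⊤ :=
        eq_top_of_forall_coprime_mem hp hperf fun g hg =>
          Subgroup.mem_centralizer_iff.2 fun d hd =>
            (hcon D (Subgroup.normalizer_eq_top_iff.1 hDn) hD g hg d hd).symm
      exact Subgroup.centralizer_eq_top_iff_subset.1 hc
    · exact Or.inr (hmin _ hDn)
  · exact isPGroup_quotient_of_forall_mem hp fun x _ => Subgroup.mem_top x

/-- A `p'`-element `g` centralises every normal subgroup of `G` properly contained in the normal
`p`-subgroup `D`, if all proper subgroups of `G` are `p`-nilpotent. -/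
lemma commute_of_ne [Finite G] {p : ℕ} (hp : p.Prime)
    (hmin : ∀ M : Subgroup G, M ≠ ⊤ → IsPNilpotent p M) {D : Subgroup G} (hD : IsPGroup p D)
    {g : G} (hg : p.Coprime (orderOf g)) {A : Subgroup G} (hA : A.Normal) (hAD : A ≤ D)
    (hne : A ≠ D) {a : G} (ha : a ∈ A) : Commute g a := by
  have hgM : g ∈ A ⊔ Subgroup.zpowers g := Subgroup.mem_sup_right (Subgroup.mem_zpowers g)
  by_cases hM : A ⊔ Subgroup.zpowers g = ⊤
  · refine absurd (le_antisymm hAD fun d hd => ?_) hne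
    obtain ⟨b, hb, z, hz, rfl⟩ := Subgroup.mem_sup_of_normal_left.1 (hM ▸ Subgroup.mem_top d)
    have h1 : z ∈ D := (Subgroup.mul_mem_cancel_left D (hAD hb)).1 hd
    have h2 : z = 1 := eq_one_of_coprime_of_isPGroup hD h1
      (hg.coprime_dvd_right (orderOf_dvd_of_mem_zpowers hz))
    rwa [h2, mul_one]
  · refine (hmin _ hM).commute hp (hD.to_le hAD) le_sup_left hgM ?_ hg ha
    rw [Subgroup.normalizer_eq_top]
    exact Subgroup.mem_top g

/-- A `p'`-element that does not centralise `D` acts nontrivially on each nontrivial quotient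
of `D` by a normal subgroup of `G`. -/
lemma eq_of_forall_commutator_mem [Finite G] {p : ℕ} (hp : p.Prime)
    (hmin : ∀ M : Subgroup G, M ≠ ⊤ → IsPNilpotent p M) {D : Subgroup G} (hD : IsPGroup p D)
    {g : G} (hg : p.Coprime (orderOf g)) (hnc : ∃ d ∈ D, ¬ Commute g d) {A : Subgroup G}
    (hA : A.Normal) (hAD : A ≤ D) (h : ∀ d ∈ D, d⁻¹ * (g * d * g⁻¹) ∈ A) : A = D := by
  by_contra hne
  obtain ⟨d, hd, hgd⟩ := hnc
  exact hgd (commute_of_commutator_commute hD hg (hAD (h d hd))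
    (commute_of_ne hp hmin hD hg hA hAD hne (h d hd)) (by group))

/-- An element of order prime to `φ(|x|)` acts trivially on a normal section `B / A` that is
covered by the cyclic group generated by `x`. -/
lemma commutator_mem_of_le_sup_zpowers [Finite G] {A B : Subgroup G} (hA : A.Normal)
    (hB : B.Normal) {x g : G} (hBx : B ≤ A ⊔ Subgroup.zpowers x)
    (hg : (orderOf g).Coprime (orderOf x).totient) {b : G} (hb : b ∈ B) :
    b⁻¹ * (g * b * g⁻¹) ∈ A := by
  have hle : B.map (QuotientGroup.mk' A) ≤ Subgroup.zpowers (x : G ⧸ A) := by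
    refine (Subgroup.map_mono hBx).trans ?_
    rw [Subgroup.map_sup, QuotientGroup.map_mk'_self, bot_sup_eq, MonoidHom.map_zpowers]
    rfl
  have hcyc : IsCyclic (B.map (QuotientGroup.mk' A)) :=
    isCyclic_of_injective (Subgroup.inclusion hle) (Subgroup.inclusion_injective hle)
  have hBn : (B.map (QuotientGroup.mk' A)).Normal := hB.map _ (QuotientGroup.mk'_surjective A)
  have hcard : Nat.card (B.map (QuotientGroup.mk' A)) ∣ orderOf x :=
    (Subgroup.card_dvd_of_le hle).trans
      (Nat.card_zpowers (x : G ⧸ A) ▸ orderOf_map_dvd (QuotientGroup.mk' A) x)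
  have h1 : Commute (g : G ⧸ A) b := commute_of_isCyclic_of_coprime_totient _
    ((hg.coprime_dvd_right (Nat.totient_dvd_of_dvd hcard)).coprime_dvd_left
      (orderOf_map_dvd (QuotientGroup.mk' A) g)) ⟨b, hb, rfl⟩
  rw [← QuotientGroup.eq_one_iff]
  have h2 : (b : G ⧸ A)⁻¹ * (g * b * (g : G ⧸ A)⁻¹) = 1 := by rw [h1.eq]; group
  exact h2

/-- No cyclic subgroup of `D` of suitable order has a `p`-nilpotent supplement: a maximal subgroup
`M` above the supplement meets `D` in a normal subgroup with cyclic quotient, on which `g` acts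
trivially. -/
lemma not_hasPNilpotentSupplement [Finite G] {p : ℕ} (hp : p.Prime) (hG : ¬ IsPNilpotent p G)
    (hmin : ∀ M : Subgroup G, M ≠ ⊤ → IsPNilpotent p M) {D : Subgroup G} (hDn : D.Normal)
    (hD : IsPGroup p D) {g : G} (hg : p.Coprime (orderOf g)) (hnc : ∃ d ∈ D, ¬ Commute g d)
    {x : G} (hx : x ∈ D) (hgx : (orderOf g).Coprime (orderOf x).totient) :
    ¬ HasPNilpotentSupplement p (Subgroup.zpowers x) := by
  rintro ⟨K, hK, hKp⟩
  rw [Set.eq_univ_iff_forall] at hK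
  have hKtop : K ≠ ⊤ := by
    rintro rfl
    exact hG ((isPNilpotent_top_iff hp).1 hKp)
  obtain ⟨M, hM, hKM⟩ := (eq_top_or_exists_le_coatom K).resolve_left hKtop
  have hxD : Subgroup.zpowers x ≤ D := Subgroup.zpowers_le.2 hx
  have hDM : ¬ D ≤ M := by
    intro hDM
    refine hM.1 (top_le_iff.1 fun y _ => ?_)
    obtain ⟨a, ha, k, hk, rfl⟩ := hK y
    exact M.mul_mem (hDM (hxD ha)) (hKM hk)
  have hAD : M ⊓ D < D := lt_of_le_of_ne inf_le_right fun h => hDM (inf_eq_right.1 h)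
  have hMN : M ≤ Subgroup.normalizer ((M ⊓ D : Subgroup G) : Set G) := by
    intro m hm
    rw [Subgroup.mem_normalizer_iff]
    refine fun y => and_congr (Subgroup.mem_normalizer_iff.1 (Subgroup.le_normalizer hm) y) ?_
    exact ⟨fun hy => hDn.conj_mem y hy m, fun hy => by
      simpa [mul_assoc] using hDn.conj_mem _ hy m⁻¹⟩
  obtain ⟨y, hyD, hyA, hyN⟩ := exists_mem_normalizer_of_lt hp hD hAD
  have hA : (M ⊓ D).Normal := by
    refine Subgroup.normalizer_eq_top_iff.1 (hM.2 _ (lt_of_le_of_ne hMN ?_))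
    rintro h
    exact hyA ⟨h ▸ hyN, hyD⟩
  refine hAD.ne (eq_of_forall_commutator_mem hp hmin hD hg hnc hA hAD.le fun d hd =>
    commutator_mem_of_le_sup_zpowers hA hDn (fun e he => ?_) hgx hd)
  obtain ⟨a, ha, k, hk, rfl⟩ := hK e
  exact Subgroup.mul_mem _ (Subgroup.mem_sup_right ha) (Subgroup.mem_sup_left
    ⟨hKM hk, (Subgroup.mul_mem_cancel_left D (hxD ha)).1 he⟩)

/-- The `p'`-element `g` centralises the centrally embedded cyclic subgroups `⟨x⟩` of `D` of
suitable order. Both `T ∩ D` and `HT ∩ D` are normal in `G`; either the second is proper in `D`, or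
`D ≤ T`. -/
lemma IsCentrallyEmbedded.commute [Finite G] {p : ℕ} (hp : p.Prime)
    (hmin : ∀ M : Subgroup G, M ≠ ⊤ → IsPNilpotent p M)
    (hperf : ∀ N : Subgroup G, ∀ _ : N.Normal, IsPGroup p (G ⧸ N) → N = ⊤)
    {D : Subgroup G} (hDn : D.Normal) (hD : IsPGroup p D) {g : G} (hg : p.Coprime (orderOf g))
    (hnc : ∃ d ∈ D, ¬ Commute g d) {x : G} (hx : x ∈ D)
    (hgx : (orderOf g).Coprime (orderOf x).totient)
    (h : IsCentrallyEmbedded p (Subgroup.zpowers x)) : Commute g x := by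
  obtain ⟨T, R, C, hT, hR, hRT, hC, hCH, h⟩ := h
  have hnormal : ∀ S : Subgroup G, IsSQuasinormal S → (S ⊓ D).Normal := fun S hS =>
    Subgroup.normalizer_eq_top_iff.1 (eq_top_of_forall_coprime_mem hp hperf fun y hy =>
      hS.mem_normalizer_inf hp hD hy)
  have hxD : Subgroup.zpowers x ≤ D := Subgroup.zpowers_le.2 hx
  have hxR : x ∈ R := by
    rw [← SetLike.mem_coe, hRT]
    exact ⟨x, Subgroup.mem_zpowers x, 1, T.one_mem, mul_one x⟩
  by_cases hRD : R ⊓ D = D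
  · have hTD : T ⊓ D = D := by
      refine eq_of_forall_commutator_mem hp hmin hD hg hnc (hnormal T hT) inf_le_right fun d hd =>
        commutator_mem_of_le_sup_zpowers (hnormal T hT) hDn (fun e he => ?_) hgx hd
      have he' : e ∈ (R : Set G) := (hRD.symm.le he).1
      rw [hRT] at he'
      obtain ⟨a, ha, t, ht, rfl⟩ := he'
      exact Subgroup.mul_mem _ (Subgroup.mem_sup_right ha) (Subgroup.mem_sup_left
        ⟨ht, (Subgroup.mul_mem_cancel_left D (hxD ha)).1 he⟩)
    have hxT : x ∈ T := (hTD.symm.le hx).1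
    have hk := h D hD g hg (fun d hd => hDn.conj_mem d hd g) x hx (Subgroup.mem_zpowers x) hxT
    have hcyc : IsCyclic C :=
      isCyclic_of_injective (Subgroup.inclusion hCH) (Subgroup.inclusion_injective hCH)
    have hcard : Nat.card C ∣ orderOf x :=
      Nat.card_zpowers x ▸ Subgroup.card_dvd_of_le hCH
    exact commute_of_commutator_commute hD hg (hxD (hCH hk))
      (commute_of_isCyclic_of_coprime_totient C
        (hgx.coprime_dvd_right (Nat.totient_dvd_of_dvd hcard)) hk) (by group)
  · exact commute_of_ne hp hmin hD hg (hnormal R hR) inf_le_right hRD ⟨hxR, hx⟩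

/-- A finite nontrivial `p`-group has a proper subgroup that contains all `p`-th powers and all
commutators. -/
lemma exists_ne_top_pow_commutator_mem {P : Type*} [Group P] [Finite P] [Nontrivial P] {p : ℕ}
    (hp : p.Prime) (hP : IsPGroup p P) :
    ∃ M : Subgroup P, M ≠ ⊤ ∧ (∀ x : P, x ^ p ∈ M) ∧ ∀ x y : P, x⁻¹ * y⁻¹ * x * y ∈ M := by
  have := Fact.mk hp
  obtain ⟨n, hn, hcard⟩ := hP.nontrivial_iff_card.1 inferInstance
  obtain ⟨m, rfl⟩ := Nat.exists_eq_succ_of_ne_zero hn.ne'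
  obtain ⟨M, hM⟩ := Sylow.exists_subgroup_card_pow_prime (G := P) p (n := m)
    (hcard ▸ pow_dvd_pow p m.le_succ)
  have hidx : M.index = p := by
    have h1 := M.card_mul_index
    rw [hM, hcard, pow_succ] at h1
    exact Nat.eq_of_mul_eq_mul_left (pow_pos hp.pos m) h1
  have hMn : M.Normal := Subgroup.normal_of_index_eq_minFac_card (by
    rw [hidx, hcard, hp.pow_minFac (Nat.succ_ne_zero m)])
  refine ⟨M, ?_, fun x => hidx ▸ M.pow_index_mem x, fun x y => ?_⟩
  · rintro rfl
    rw [Subgroup.index_top] at hidx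
    exact hp.ne_one hidx.symm
  · have hcyc : IsCyclic (P ⧸ M) := isCyclic_of_prime_card (p := p) hidx
    rw [← QuotientGroup.eq_one_iff]
    have h1 : (x : P ⧸ M) * y = y * x := hcyc.isMulCommutative.is_comm.comm _ _
    have h2 : (x : P ⧸ M)⁻¹ * (y : P ⧸ M)⁻¹ * x * y = 1 := by
      rw [mul_assoc, h1]; group
    exact h2

lemma mul_pow_of_commutator {a b c : G} (h : b * a = a * b * c) (ha : Commute c a)
    (hb : Commute c b) (n : ℕ) : (a * b) ^ n = a ^ n * b ^ n * c ^ n.choose 2 := by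
  have h1 : ∀ n : ℕ, b ^ n * a = a * b ^ n * c ^ n := by
    intro n
    induction n with
    | zero => simp
    | succ n ih =>
      calc b ^ (n + 1) * a = b * (b ^ n * a) := by rw [pow_succ', mul_assoc]
        _ = (b * a) * b ^ n * c ^ n := by rw [ih]; group
        _ = a * b * (c * b ^ n) * c ^ n := by rw [h]; group
        _ = a * b * (b ^ n * c) * c ^ n := by rw [(hb.pow_right n).eq]
        _ = a * b ^ (n + 1) * c ^ (n + 1) := by rw [pow_succ', pow_succ']; group
  induction n with
  | zero => simp
  | succ n ih =>
    have h2 : Commute (c ^ n.choose 2) (a * b) := (ha.mul_right hb).pow_left _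
    calc (a * b) ^ (n + 1) = a ^ n * b ^ n * (c ^ n.choose 2 * (a * b)) := by
          rw [pow_succ, ih, mul_assoc]
      _ = a ^ n * (b ^ n * a) * b * c ^ n.choose 2 := by rw [h2.eq]; group
      _ = a ^ n * a * b ^ n * (c ^ n * b) * c ^ n.choose 2 := by rw [h1]; group
      _ = a ^ n * a * b ^ n * (b * c ^ n) * c ^ n.choose 2 := by rw [(hb.pow_left n).eq]
      _ = a ^ (n + 1) * b ^ (n + 1) * c ^ (n + 1).choose 2 := by
          rw [Nat.choose_succ_succ' n 1, Nat.choose_one_right, pow_add c, pow_succ, pow_succ]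
          simp only [mul_assoc]

/-- Under the minimality hypotheses a `p'`-element that centralises all elements of `D` of order `p`
(and of order `4` if `D` is a non-abelian `2`-group) centralises `D`. Here the subgroup generated
by the `p`-th powers and the commutators of `D` turns out central in `D` and centralised by `g`, so
that each `d⁻¹ (g d g⁻¹)` has order at most `p`, or order dividing `4`. -/
lemma false_of_forall_commute [Finite G] {p : ℕ} (hp : p.Prime)
    (hmin : ∀ M : Subgroup G, M ≠ ⊤ → IsPNilpotent p M)
    {D : Subgroup G} (hDn : D.Normal) (hD : IsPGroup p D) {g : G} (hg : p.Coprime (orderOf g))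
    (hnc : ∃ d ∈ D, ¬ Commute g d)
    (h : ∀ x ∈ D, (orderOf x = p ∨ (orderOf x = 4 ∧ p = 2 ∧ ¬ ∀ a ∈ D, ∀ b ∈ D, a * b = b * a)) →
      Commute g x) : False := by
  have := Fact.mk hp
  let A : Subgroup G := Subgroup.closure
    ({z | ∃ x ∈ D, x ^ p = z} ∪ {z | ∃ x ∈ D, ∃ y ∈ D, x⁻¹ * y⁻¹ * x * y = z})
  have hpow : ∀ x ∈ D, x ^ p ∈ A := fun x hx => Subgroup.subset_closure (Or.inl ⟨x, hx, rfl⟩)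
  have hcomm : ∀ x ∈ D, ∀ y ∈ D, x⁻¹ * y⁻¹ * x * y ∈ A := fun x hx y hy =>
    Subgroup.subset_closure (Or.inr ⟨x, hx, y, hy, rfl⟩)
  have hA : A.Normal := by
    refine ⟨fun n hn t => ?_⟩
    have hle : A ≤ A.comap (MulAut.conj t).toMonoidHom := by
      rw [Subgroup.closure_le]
      rintro _ (⟨x, hx, rfl⟩ | ⟨x, hx, y, hy, rfl⟩)
      · have := hpow _ (hDn.conj_mem x hx t)
        rw [conj_pow] at this
        exact this
      · have := hcomm _ (hDn.conj_mem x hx t) _ (hDn.conj_mem y hy t)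
        change t * (x⁻¹ * y⁻¹ * x * y) * t⁻¹ ∈ A
        convert this using 1
        group
    exact hle hn
  have hAD : A ≤ D := by
    rw [Subgroup.closure_le]
    rintro _ (⟨x, hx, rfl⟩ | ⟨x, hx, y, hy, rfl⟩)
    · exact D.pow_mem hx p
    · exact D.mul_mem (D.mul_mem (D.mul_mem (D.inv_mem hx) (D.inv_mem hy)) hx) hy
  have hne : A ≠ D := by
    have hnt : Nontrivial D := by
      rw [Subgroup.nontrivial_iff_ne_bot]
      intro hbot
      obtain ⟨d, hd, hgd⟩ := hnc
      rw [hbot] at hd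
      rw [Subgroup.mem_bot.1 hd] at hgd
      exact hgd (Commute.one_right g)
    obtain ⟨M, hM, hMp, hMc⟩ := exists_ne_top_pow_commutator_mem hp hD
    intro hAeq
    refine hM (top_le_iff.1 fun d _ => ?_)
    have hle : A ≤ M.map D.subtype := by
      rw [Subgroup.closure_le]
      rintro _ (⟨x, hx, rfl⟩ | ⟨x, hx, y, hy, rfl⟩)
      · exact ⟨_, hMp ⟨x, hx⟩, rfl⟩
      · exact ⟨_, hMc ⟨x, hx⟩ ⟨y, hy⟩, rfl⟩
    obtain ⟨m, hm, hmd⟩ := hle (hAeq.symm.le d.2)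
    have hmd' : m = d := Subtype.ext hmd
    exact hmd' ▸ hm
  have hgA : ∀ a ∈ A, Commute g a := fun a ha => commute_of_ne hp hmin hD hg hA hAD hne ha
  -- The centraliser of `A` is normal and contains `g`, hence all `d⁻¹ (g d g⁻¹)`.
  have hcent : Subgroup.centralizer (A : Set G) ⊓ D = D := by
    have hn : (Subgroup.centralizer (A : Set G) ⊓ D).Normal := inferInstance
    refine eq_of_forall_commutator_mem hp hmin hD hg hnc hn inf_le_right fun d hd => ?_
    have hgc : g ∈ Subgroup.centralizer (A : Set G) :=
      Subgroup.mem_centralizer_iff.2 fun a ha => (hgA a ha).symm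
    refine ⟨?_, D.mul_mem (D.inv_mem hd) (hDn.conj_mem d hd g)⟩
    have hcn : (Subgroup.centralizer (A : Set G)).Normal := inferInstance
    have h1 := Subgroup.mul_mem _ (hcn.conj_mem g hgc d⁻¹) (Subgroup.inv_mem _ hgc)
    simpa [mul_assoc] using h1
  have hAc : ∀ a ∈ A, ∀ d ∈ D, Commute a d := fun a ha d hd =>
    Subgroup.mem_centralizer_iff.1 (hcent.symm.le hd).1 a ha
  obtain ⟨x, hx, hgx⟩ := hnc
  have hxi := D.inv_mem hx
  have hy : g * x * g⁻¹ ∈ D := hDn.conj_mem x hx g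
  set y := g * x * g⁻¹ with hydef
  set c := y⁻¹ * x * y * x⁻¹ with hcdef
  have hcA : c ∈ A := by
    have := hcomm y hy x⁻¹ hxi
    simpa [hcdef] using this
  have hk : x⁻¹ * y ∈ D := D.mul_mem hxi hy
  have hpowk : (x⁻¹ * y) ^ p = c ^ p.choose 2 := by
    rw [mul_pow_of_commutator (c := c) (by rw [hcdef]; group) (hAc c hcA _ hxi) (hAc c hcA _ hy)]
    have h1 : y ^ p = x ^ p := by
      rw [hydef, conj_pow, (hgA _ (hpow x hx)).eq, mul_inv_cancel_right]
    rw [h1, inv_pow, inv_mul_cancel, one_mul]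
  have hcp : c ^ p = 1 := by
    have h1 : y⁻¹ * x * y = c * x := by rw [hcdef]; group
    have h2 : (y⁻¹ * x * y) ^ p = y⁻¹ * x ^ p * y := by
      simpa using conj_pow (a := y⁻¹) (b := x) (i := p)
    have h3 : y⁻¹ * x ^ p * y = x ^ p := by
      rw [mul_assoc, (hAc _ (hpow x hx) y hy).eq, inv_mul_cancel_left]
    rw [h1, (hAc c hcA x hx).mul_pow, h3] at h2
    exact mul_eq_right.1 h2
  have hgk : Commute g (x⁻¹ * y) := by
    have key : (x⁻¹ * y) ^ p = 1 → Commute g (x⁻¹ * y) := by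
      intro h1
      rcases (Nat.dvd_prime hp).1 (orderOf_dvd_of_pow_eq_one h1) with h2 | h2
      · rw [orderOf_eq_one_iff.1 h2]; exact Commute.one_right g
      · exact h _ hk (Or.inl h2)
    rcases hp.eq_two_or_odd' with h2 | hodd
    · subst h2
      have h4 : (x⁻¹ * y) ^ 2 = c := by rw [hpowk]; simp
      by_cases hab : ∀ a ∈ D, ∀ b ∈ D, a * b = b * a
      · refine key (h4.trans ?_)
        rw [hcdef, mul_assoc y⁻¹, hab x hx y hy]
        group
      · by_cases hc1 : c = 1
        · exact key (h4.trans hc1)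
        · refine h _ hk (Or.inr ⟨?_, rfl, hab⟩)
          refine orderOf_eq_prime_pow (p := 2) (n := 1) ?_ ?_
          · rwa [pow_one, h4]
          · rw [pow_succ, pow_one, pow_mul, h4, hcp]
    · refine key ?_
      obtain ⟨m, hm⟩ : p ∣ p.choose 2 :=
        hp.dvd_choose_self two_ne_zero (lt_of_le_of_ne hp.two_le (by
          rintro rfl
          exact absurd hodd (by decide)))
      rw [hpowk, hm, pow_mul, hcp, one_pow]
  exact hgx (commute_of_commutator_commute hD hg hk hgk (by rw [mul_inv_cancel_left]))

/-! ### The criterion -/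

/-- The case of the whole group, with weak quasinormality replaced by its hereditary
consequence. -/
theorem isPNilpotent_of_forall_isCentrallyEmbedded [Finite G] {p : ℕ} (hp : p.Prime)
    (hcop : (Nat.card G).Coprime (p - 1))
    (h : ∀ x : G, (orderOf x = p ∨ (orderOf x = 4 ∧ p = 2 ∧
        ∃ D : Subgroup G, IsPGroup p D ∧ ¬ ∀ a ∈ D, ∀ b ∈ D, a * b = b * a)) →
      IsCentrallyEmbedded p (Subgroup.zpowers x) ∨
        HasPNilpotentSupplement p (Subgroup.zpowers x)) : IsPNilpotent p G := by
  induction hn : Nat.card G using Nat.strong_induction_on generalizing G with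
  | h n ih =>
  subst hn
  by_contra hG
  have hmin : ∀ M : Subgroup G, M ≠ ⊤ → IsPNilpotent p M := by
    intro M hM
    refine ih (Nat.card M) (lt_of_le_of_ne (Subgroup.card_le_card_group M) fun h =>
      hM (Subgroup.eq_top_of_card_eq M h))
      (hcop.coprime_dvd_left (Subgroup.card_subgroup_dvd_card M)) (fun x hx => ?_) rfl
    have hle : Subgroup.zpowers (x : G) ≤ M := Subgroup.zpowers_le.2 x.2
    rw [← zpowers_coe_subgroupOf]
    refine (h x ?_).imp (fun h => h.subgroupOf hle) fun h => h.subgroupOf hp hle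
    rw [Subgroup.orderOf_coe]
    refine hx.imp id fun ⟨h4, h2, D, hD, hDc⟩ => ⟨h4, h2, D.map M.subtype, hD.map _, fun hc => ?_⟩
    refine hDc fun a ha b hb => Subtype.ext ?_
    exact hc a ⟨a, ha, rfl⟩ b ⟨b, hb, rfl⟩
  have hperf : ∀ N : Subgroup G, ∀ _ : N.Normal, IsPGroup p (G ⧸ N) → N = ⊤ := fun N _ hN =>
    by_contra fun hne => hG (isPNilpotent_of_isPGroup_quotient hp (hmin N hne) hN)
  obtain ⟨D, hDn, hD, g, hg, hnc⟩ := exists_normal_not_commute hp hG hmin hperf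
  refine false_of_forall_commute hp hmin hDn hD hg hnc fun x hx hord => ?_
  have hgx : (orderOf g).Coprime (orderOf x).totient := by
    rcases hord with h1 | ⟨h1, h2, -⟩
    · rw [h1, Nat.totient_prime hp]
      exact hcop.coprime_dvd_left (orderOf_dvd_natCard g)
    · subst h2
      rw [h1]
      exact hg.symm
  rcases h x (hord.imp id fun ⟨h4, h2, hDc⟩ => ⟨h4, h2, D, hD, hDc⟩) with h1 | h1
  · exact h1.commute hp hmin hperf hDn hD hg hnc hx hgx
  · exact absurd h1 (not_hasPNilpotentSupplement hp hG hmin hDn hD hg hnc hx hgx)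

/-- A `p`-subgroup of `E` is conjugate in `G` to a subgroup of a given Sylow `p`-subgroup of `E`. -/
lemma exists_conj_smul_le_map [Finite G] {p : ℕ} (hp : p.Prime) {E : Subgroup G} (P : Sylow p E)
    {D : Subgroup G} (hD : IsPGroup p D) (hDE : D ≤ E) :
    ∃ e : G, MulAut.conj e • D ≤ (P : Subgroup E).map E.subtype := by
  have := Fact.mk hp
  obtain ⟨Q, hQ⟩ := (hD.comap_subtype (K := E)).exists_le_sylow
  obtain ⟨e, he⟩ := MulAction.exists_smul_eq E Q P
  refine ⟨e, ?_⟩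
  rintro _ ⟨d, hd, rfl⟩
  have h1 : (⟨d, hDE hd⟩ : E) ∈ Q := hQ hd
  refine ⟨e * ⟨d, hDE hd⟩ * e⁻¹, ?_, rfl⟩
  rw [← he]
  exact ⟨_, h1, rfl⟩

theorem isPNilpotent_of_isPNilpotent_quotient [Finite G] {p : ℕ} (hp : p.Prime)
    (hcop : Nat.Coprime (Nat.card G) (p - 1))
    (E : Subgroup G) [E.Normal] (hE : IsPNilpotent p (G ⧸ E))
    (P : Sylow p E)
    (h : ∀ H : Subgroup G, H ≤ (P : Subgroup E).map E.subtype → IsCyclic H →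
      (Nat.card H = p ∨ (Nat.card H = 4 ∧ p = 2 ∧ ¬ IsMulCommutative (P : Subgroup E))) →
      IsWeaklyFsQuasinormal (fun X [Group X] => IsPSupersoluble p X) H ∨
        HasPNilpotentSupplement p H) :
    IsPNilpotent p G := by
  obtain ⟨N, hN, hNcard, hNq⟩ := hE
  -- The preimage `E'` of the `p`-complement of `G / E` has `p`-power index in `G`, and its
  -- `p`-subgroups lie in `E`.
  let E' : Subgroup G := N.comap (QuotientGroup.mk' E)
  have hE'q : IsPGroup p (G ⧸ E') := isPGroup_quotient_of_forall_mem hp fun x hx =>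
    mem_of_coprime_of_isPGroup_quotient hNq
      (hx.coprime_dvd_right (orderOf_map_dvd (QuotientGroup.mk' E) x))
  have hE' : ∀ D : Subgroup G, IsPGroup p D → D ≤ E' → D ≤ E := by
    intro D hD hDE' d hd
    rw [← QuotientGroup.eq_one_iff]
    have h1 : p.Coprime (orderOf (d : G ⧸ E)) :=
      ((Nat.Prime.coprime_iff_not_dvd hp).2 hNcard).coprime_dvd_right
        (Subgroup.orderOf_dvd_natCard N (hDE' hd))
    exact eq_one_of_coprime_of_isPGroup (hD.map (QuotientGroup.mk' E)) ⟨d, hd, rfl⟩ h1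
  refine isPNilpotent_of_isPGroup_quotient hp (N := E') ?_ hE'q
  refine isPNilpotent_of_forall_isCentrallyEmbedded hp
    (hcop.coprime_dvd_left (Subgroup.card_subgroup_dvd_card E')) fun x hx => ?_
  have hle : Subgroup.zpowers (x : G) ≤ E' := Subgroup.zpowers_le.2 x.2
  rw [← zpowers_coe_subgroupOf]
  have hxp : IsPGroup p (Subgroup.zpowers (x : G)) := by
    rcases hx with h1 | ⟨h1, h2, -⟩
    · refine IsPGroup.of_card (n := 1) ?_
      rw [Nat.card_zpowers, Subgroup.orderOf_coe, h1, pow_one]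
    · refine IsPGroup.of_card (n := 2) ?_
      rw [Nat.card_zpowers, Subgroup.orderOf_coe, h1, h2]; norm_num
  obtain ⟨e, he⟩ := exists_conj_smul_le_map hp P hxp (hE' _ hxp hle)
  have hcard : Nat.card (MulAut.conj e • Subgroup.zpowers (x : G) : Subgroup G) = orderOf x := by
    rw [← Subgroup.orderOf_coe, ← Nat.card_zpowers]
    exact Nat.card_congr (Subgroup.equivSMul (MulAut.conj e) _).symm.toEquiv
  have hcyc : IsCyclic (MulAut.conj e • Subgroup.zpowers (x : G) : Subgroup G) :=
    (Subgroup.equivSMul (MulAut.conj e) (Subgroup.zpowers (x : G))).isCyclic.1 inferInstance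
  have hord : orderOf x = p ∨ (orderOf x = 4 ∧ p = 2 ∧ ¬ IsMulCommutative (P : Subgroup E)) := by
    refine hx.imp id fun ⟨h4, h2, D, hD, hDc⟩ => ⟨h4, h2, fun hP => hDc fun a ha b hb => ?_⟩
    have hDle : D.map E'.subtype ≤ E' := Subgroup.map_subtype_le D
    obtain ⟨f, hf⟩ := exists_conj_smul_le_map hp P (hD.map _) (hE' _ (hD.map _) hDle)
    obtain ⟨a', ha', haa⟩ := hf ⟨a, ⟨a, ha, rfl⟩, rfl⟩
    obtain ⟨b', hb', hbb⟩ := hf ⟨b, ⟨b, hb, rfl⟩, rfl⟩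
    have h1 : a' * b' = b' * a' :=
      congrArg Subtype.val (hP.is_comm.comm (⟨a', ha'⟩ : P) ⟨b', hb'⟩)
    apply Subtype.ext
    apply (MulAut.conj f).injective
    have h3 : (MulAut.conj f) ((a : G) * b) = (a' * b' : E) := by
      rw [map_mul]; exact congrArg₂ (· * ·) haa.symm hbb.symm
    have h4 : (MulAut.conj f) ((b : G) * a) = (b' * a' : E) := by
      rw [map_mul]; exact congrArg₂ (· * ·) hbb.symm haa.symm
    exact h3.trans ((congrArg Subtype.val h1).trans h4.symm)
  rcases h _ he hcyc (by rwa [hcard]) with h1 | h1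
  · left
    have h2 := (h1.isCentrallyEmbedded hp hcop).conj_smul e⁻¹
    rw [map_inv, inv_smul_smul] at h2
    exact h2.subgroupOf hle
  · exact Or.inr (h1.of_conj_smul.subgroupOf hp hle)

end WeakQN

theorem theoremC6 {G : Type u} [Group G] [Finite G] (p : ℕ) (hp : p.Prime)
    (hpG : p ∣ Nat.card G) (hcop : Nat.Coprime (Nat.card G) (p - 1))
    (E : Subgroup G) [E.Normal] (hE : WeakQN.IsPNilpotent p (G ⧸ E))
    (P : Sylow p E)
    (h : ∀ H : Subgroup G, H ≤ (P : Subgroup E).map E.subtype → IsCyclic H →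
      (Nat.card H = p ∨ (Nat.card H = 4 ∧ p = 2 ∧ ¬ IsMulCommutative (P : Subgroup E))) →
      WeakQN.IsWeaklyFsQuasinormal (fun X [Group X] => WeakQN.IsPSupersoluble p X) H ∨
        WeakQN.HasPNilpotentSupplement p H) :
    WeakQN.IsPNilpotent p G :=
  WeakQN.isPNilpotent_of_isPNilpotent_quotient hp hcop E hE P h
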